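/- **Setting.** Let $T\ge 2$ and let $p,n,M\ge 0$ be integers such that $t-1$ divides $M$ for every $2\le t\le T$; let $\sigma\ge 0$ and let $w_1^*,\dots,w_T^*\in\mathbb R^p$ be fixed. At task $t\in\{1,\dots,T\}$ the learner has a current dataset $(X_{t,0},Y_{t,0})$ with $n$ samples and, for every previous task $h\in\{1,\dots,t-1\}$, a memory dataset $(X_{t,h},Y_{t,h})$ with $M/(t-1)$ fresh samples, where $$Y_{t,0}=X_{t,0}^\top w_t^*+z_{t,0},\qquad Y_{t,h}=X_{t,h}^\top w_h^*+z_{t,h}\quad(1\le h\le t-1),$$ all entries of the matrices $X_{t,h}$ (with $p$ rows and one column per sample) are $\mathcal N(0,1)$, all entries of the vectors $z_{t,h}$ are $\mathcal N(0,\sigma^2)$, and all these scalars are jointly independent. Put $w_0=0$. * *Concurrent rehearsal*: $w_t=\arg\min_w\|w-w_{t-1}\|^2$ subject to $X_{t,h}^\top w=Y_{t,h}$ for all $h=0,\dots,t-1$. * *Sequential rehearsal*: $w_t^{(-1)}=w_{t-1}$, $w_t^{(h)}=\arg\min_w\|w-w_t^{(h-1)}\|^2$ subject to $X_{t,h}^\top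 w=Y_{t,h}$ for $h=0,1,\dots,t-1$ in turn, and $w_t=w_t^{(t-1)}$. Let $\mathcal L_i(w)=\|w-w_i^*\|^2$, $F_T=\frac1{T-1}\sum_{i=1}^{T-1}\mathbb E[\mathcal L_i(w_T)-\mathcal L_i(w_i)]$ and $G_T=\frac1T\sum_{i=1}^{T}\mathbb E[\mathcal L_i(w_T)]$. **Theorem.** Assume $p>n+M+1$ for concurrent rehearsal, and $p>n+1$ and $p>M+1$ for sequential rehearsal. Then for each of the two methods all $\mathcal L_i(w_t)$ with $1\le i,t\le T$ are integrable, and $$F_T=\frac1{T-1}\Big[\sum_{i=1}^{T-1}c_i\|w_i^*\|^2+\sum_{i=1}^{T-1}\sum_{j,k=1}^{T}c_{ijk}\|w_j^*-w_k^*\|^2+\sum_{i=1}^{T-1}\big(\mathrm{noise}_T(\sigma)-\mathrm{noise}_i(\sigma)\big)\Big],$$ $$G_T=\frac1T\Big[d_{0T}\sum_{i=1}^{T}\|w_i^*\|^2+\sum_{i=1}^{T}\sum_{j,k=1}^{T}d_{ijkT}\|w_j^*-w_k^*\|^2\Big]+\mathrm{noise}_T(\sigma),$$ where $c_i=d_{0T}-d_{0i}$,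 $c_{ijk}=d_{ijkT}-d_{ijki}$ and, with $r_a=1-\frac{n+a}p$, $B_{l,t}=\frac{M}{(t-l-1)p}$ for $l\ne t-1$, $B_{t-1,t}=0$, $H_{l,t}=\frac{B_{l,t}}{p-n-M-1}$, $\Delta_t(a)=\prod_{l=0}^{a-1}\big[(1-B_{l,t})^{t-l-1}r_0\big]$ and $\Lambda_{a,\sigma}=\frac{a\sigma^2}{p-a-1}$, the remaining quantities are as follows. *Concurrent:* $d_{0t}=r_0r_M^{t-1}$ and $$\mathrm{noise}_t(\sigma)=r_M^{t-1}\Lambda_{n,\sigma}+\sum_{l=0}^{t-2}r_M^l\Lambda_{n+M,\sigma}.$$ For $1\le j<k\le t$ put $$b_{jkt}=\sum_{l=0}^{t-k-1}p\,r_M^lB_{l,t}H_{l,t}+r_M^{t-k}nH_{t-k,t},$$ and $b_{jkt}=0$ for all other $j,k$. For $j\le t$ put $a_{jt}=(1-r_0)r_M^{t-j}+\sum_{l=0}^{t-j-1}r_M^lB_{l,t}$, and $a_{jt}=0$ for $j>t$. Then $d_{ijkt}=a_{jt}+b_{\min(i,j),\max(i,j),t}$ if $k=i$; $d_{ijkt}=b_{jkt}$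 if $j,k\ne i$; and $d_{ijkt}=0$ otherwise. *Sequential:* $d_{0t}=r_0\Delta_t(t-1)$; $$d_{ijkt}=(1-r_0)(1-B_{t-j,t})^{j-1}\Delta_t(t-j)+\sum_{l=0}^{t-j-1}\Delta_t(l)(1-B_{l,t})^{t-j-l-1}B_{l,t}$$ if $k=i$ and $j\le t$, and $d_{ijkt}=0$ otherwise; $$\mathrm{noise}_t(\sigma)=\Delta_t(t-1)\Lambda_{n,\sigma}+\sum_{l=0}^{t-2}\Delta_t(l)\Big[(1-B_{l,t})^{t-l-1}\Lambda_{n,\sigma}+\sum_{j=1}^{t-l-1}(1-B_{l,t})^{t-l-1-j}\Lambda_{\frac{M}{t-l-1},\sigma}\Big].$$ In particular, the coefficients depend only on $p,n,M$, $T$ and the indices, and the noise terms only on $p,n,M,\sigma$ and the index. -/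

import Mathlib

open MeasureTheory ProbabilityTheory
open scoped NNReal Matrix

namespace Rehearsal

noncomputable section

/-! ### Data

At task `t` the learner has the datasets labelled `h = 0, 1, …, t - 1`: label `0` is the fresh
sample of the current task `t`, label `h ≥ 1` is the memory dataset of the previous task `h`. -/

/-- Number of samples of dataset `h` at task `t`: `n` for the current task and `M / (t - 1)` for
each of the `t - 1` memory datasets. -/
def size (n M t : ℕ) : ℕ → ℕ
  | 0 => n
  | _ + 1 => M / (t - 1)

/-- The task whose ground truth generates dataset `h` at task `t`. -/
def taskOf (t : ℕ) : ℕ → ℕ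
  | 0 => t
  | h + 1 => h + 1

/-- Feature matrices: one column per sample. -/
abbrev Features (p n M : ℕ) : Type :=
  (t h : ℕ) → Matrix (Fin p) (Fin (size n M t h)) ℝ

/-- Vectors with one entry per sample (noise or labels). -/
abbrev Outputs (n M : ℕ) : Type :=
  (t h : ℕ) → Fin (size n M t h) → ℝ

/-- Labels `Y = Xᵀ w* + z` of the linear ground truth model. -/
def labels {p n M : ℕ} (wstar : ℕ → EuclideanSpace ℝ (Fin p))
    (X : Features p n M) (z : Outputs n M) : Outputs n M :=
  fun t h => (X t h)ᵀ *ᵥ (wstar (taskOf t h)).ofLp + z t h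

/-- The datasets that occur in the tasks `1, …, T`. -/
abbrev DatasetIdx (T : ℕ) : Type :=
  {d : ℕ × ℕ // 1 ≤ d.1 ∧ d.1 ≤ T ∧ d.2 < d.1}

/-- All scalar random variables of the model: the entries of the feature matrices (left) and of the
noise vectors (right) of all datasets. -/
abbrev ScalarIdx (T p n M : ℕ) : Type :=
  Σ d : DatasetIdx T, (Fin p × Fin (size n M d.1.1 d.1.2)) ⊕ Fin (size n M d.1.1 d.1.2)

/-- The scalar random variable with a given index. -/
def scalar {T p n M : ℕ} {Ω : Type*} (X : Ω → Features p n M) (z : Ω → Outputs n M)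
    (c : ScalarIdx T p n M) (ω : Ω) : ℝ :=
  match c with
  | ⟨d, Sum.inl (a, s)⟩ => X ω d.1.1 d.1.2 a s
  | ⟨d, Sum.inr s⟩ => z ω d.1.1 d.1.2 s

/-- Standard Gaussian features, centred Gaussian noise of variance `σ ^ 2`, everything jointly
independent (in particular the memory data are fresh samples). -/
structure IsGaussianData {Ω : Type*} [MeasurableSpace Ω] (P : Measure Ω) (T p n M : ℕ) (σ : ℝ≥0)
    (X : Ω → Features p n M) (z : Ω → Outputs n M) : Prop where
  feature_law : ∀ t h, 1 ≤ t → t ≤ T → h < t → ∀ (a : Fin p) (s : Fin (size n M t h)),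
    HasLaw (fun ω => X ω t h a s) (gaussianReal 0 1) P
  noise_law : ∀ t h, 1 ≤ t → t ≤ T → h < t → ∀ s : Fin (size n M t h),
    HasLaw (fun ω => z ω t h s) (gaussianReal 0 (σ ^ 2)) P
  indep : iIndepFun (scalar (T := T) X z) P

/-! ### Training -/

/-- The point of `C` closest to `w₀` (`argmin` of `‖w - w₀‖ ^ 2` over `w ∈ C`); an unspecified
vector if there is no such point. -/
def closestPoint {p : ℕ} (C : Set (EuclideanSpace ℝ (Fin p))) (w₀ : EuclideanSpace ℝ (Fin p)) :
    EuclideanSpace ℝ (Fin p) :=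
  Classical.epsilon fun w => w ∈ C ∧ IsMinOn (fun v => ‖v - w₀‖ ^ 2) C w

/-- The parameters that fit dataset `h` of task `t` exactly. -/
def fits {p n M : ℕ} (X : Features p n M) (Y : Outputs n M) (t h : ℕ) :
    Set (EuclideanSpace ℝ (Fin p)) :=
  {w | (X t h)ᵀ *ᵥ w.ofLp = Y t h}

/-- Concurrent rehearsal: `w_0 = 0`, and `w_t` is the point closest to `w_{t-1}` that fits the
current dataset and all memory datasets of task `t` at once. -/
def concurrent {p n M : ℕ} (X : Features p n M) (Y : Outputs n M) :
    ℕ → EuclideanSpace ℝ (Fin p)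
  | 0 => 0
  | t + 1 => closestPoint {w | ∀ h < t + 1, w ∈ fits X Y (t + 1) h} (concurrent X Y t)

/-- The inner iterates `w_t^{(h)}` of sequential rehearsal at task `t`, started from `w₀`. -/
def sequentialInner {p n M : ℕ} (X : Features p n M) (Y : Outputs n M) (t : ℕ)
    (w₀ : EuclideanSpace ℝ (Fin p)) : ℕ → EuclideanSpace ℝ (Fin p)
  | 0 => closestPoint (fits X Y t 0) w₀
  | h + 1 => closestPoint (fits X Y t (h + 1)) (sequentialInner X Y t w₀ h)

/-- Sequential rehearsal: `w_0 = 0`, and `w_t = w_t^{(t-1)}` is obtained from `w_{t-1}` by fitting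
the current dataset and then the memory datasets `1, …, t - 1` one after the other. -/
def sequential {p n M : ℕ} (X : Features p n M) (Y : Outputs n M) :
    ℕ → EuclideanSpace ℝ (Fin p)
  | 0 => 0
  | t + 1 => sequentialInner X Y (t + 1) (sequential X Y t) t

/-! ### Performance metrics -/

/-- Model error `L_i(w) = ‖w - w_i*‖ ^ 2`. -/
def modelError {p : ℕ} (wstar : ℕ → EuclideanSpace ℝ (Fin p)) (i : ℕ)
    (w : EuclideanSpace ℝ (Fin p)) : ℝ :=
  ‖w - wstar i‖ ^ 2

/-- Forgetting `F_T` of a random training trajectory `w`. -/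
def forgetting {p : ℕ} {Ω : Type*} [MeasurableSpace Ω] (P : Measure Ω)
    (wstar : ℕ → EuclideanSpace ℝ (Fin p)) (w : Ω → ℕ → EuclideanSpace ℝ (Fin p)) (T : ℕ) : ℝ :=
  1 / ((T : ℝ) - 1) * ∑ i ∈ Finset.Icc 1 (T - 1),
    ∫ ω, (modelError wstar i (w ω T) - modelError wstar i (w ω i)) ∂P

/-- Generalization error `G_T` of a random training trajectory `w`. -/
def genError {p : ℕ} {Ω : Type*} [MeasurableSpace Ω] (P : Measure Ω)
    (wstar : ℕ → EuclideanSpace ℝ (Fin p)) (w : Ω → ℕ → EuclideanSpace ℝ (Fin p)) (T : ℕ) : ℝ :=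
  1 / (T : ℝ) * ∑ i ∈ Finset.Icc 1 T, ∫ ω, modelError wstar i (w ω T) ∂P

/-! ### Coefficients -/

/-- `r_a = 1 - (n + a) / p`. -/
def rCoef (p n a : ℕ) : ℝ := 1 - ((n : ℝ) + a) / p

/-- `B_{l,t} = M / ((t - l - 1) p)` for `l ≠ t - 1`, and `0` for `l = t - 1`. -/
def bCoef (p M l t : ℕ) : ℝ :=
  if l + 1 = t then 0 else (M : ℝ) / (((t : ℝ) - l - 1) * p)

/-- `H_{l,t} = B_{l,t} / (p - n - M - 1)`. -/
def hCoef (p n M l t : ℕ) : ℝ := bCoef p M l t / ((p : ℝ) - n - M - 1)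

/-- `Δ_t(a) = ∏_{l < a} (1 - B_{l,t}) ^ (t - l - 1) r_0`. -/
def deltaCoef (p n M t a : ℕ) : ℝ :=
  ∏ l ∈ Finset.range a, ((1 - bCoef p M l t) ^ (t - l - 1) * rCoef p n 0)

/-- `Λ_{a,σ} = a σ ^ 2 / (p - a - 1)`. -/
def lambdaCoef (p : ℕ) (a σ : ℝ) : ℝ := a * σ ^ 2 / ((p : ℝ) - a - 1)

/-- `d_{0t}` for concurrent rehearsal. -/
def d0Conc (p n M t : ℕ) : ℝ := rCoef p n 0 * rCoef p n M ^ (t - 1)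

/-- The contribution to the coefficient of `‖w_j* - w_k*‖ ^ 2`, for `j < k ≤ t`, of the inner
products between different datasets that are fitted together. -/
def crossConc (p n M j k t : ℕ) : ℝ :=
  if j < k ∧ k ≤ t then
    (∑ l ∈ Finset.range (t - k), p * rCoef p n M ^ l * bCoef p M l t * hCoef p n M l t)
      + rCoef p n M ^ (t - k) * n * hCoef p n M (t - k) t
  else 0

/-- `d_{ijkt}` for concurrent rehearsal; every pair of tasks that contains `i` is recorded at
`k = i`, every other pair at `j < k`. -/
def dConc (p n M i j k t : ℕ) : ℝ :=
  if k = i then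
    (if j ≤ t then
      (1 - rCoef p n 0) * rCoef p n M ^ (t - j)
        + ∑ l ∈ Finset.range (t - j), rCoef p n M ^ l * bCoef p M l t
    else 0) + crossConc p n M (min i j) (max i j) t
  else if j ≠ i then crossConc p n M j k t
  else 0

/-- `noise_t(σ)` for concurrent rehearsal. -/
def noiseConc (p n M t : ℕ) (σ : ℝ) : ℝ :=
  rCoef p n M ^ (t - 1) * lambdaCoef p n σ
    + ∑ l ∈ Finset.range (t - 1), rCoef p n M ^ l * lambdaCoef p ((n : ℝ) + M) σ

/-- `c_i` (with final task `T`) for concurrent rehearsal. -/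
def c0Conc (p n M T i : ℕ) : ℝ := d0Conc p n M T - d0Conc p n M i

/-- `c_{ijk}` (with final task `T`) for concurrent rehearsal. -/
def cConc (p n M T i j k : ℕ) : ℝ := dConc p n M i j k T - dConc p n M i j k i

/-- `d_{0t}` for sequential rehearsal. -/
def d0Seq (p n M t : ℕ) : ℝ := rCoef p n 0 * deltaCoef p n M t (t - 1)

/-- `d_{ijkt}` for sequential rehearsal. -/
def dSeq (p n M i j k t : ℕ) : ℝ :=
  if k = i ∧ j ≤ t then
    (1 - rCoef p n 0) * (1 - bCoef p M (t - j) t) ^ (j - 1) * deltaCoef p n M t (t - j)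
      + ∑ l ∈ Finset.range (t - j),
          deltaCoef p n M t l * (1 - bCoef p M l t) ^ (t - j - l - 1) * bCoef p M l t
  else 0

/-- `noise_t(σ)` for sequential rehearsal. -/
def noiseSeq (p n M t : ℕ) (σ : ℝ) : ℝ :=
  deltaCoef p n M t (t - 1) * lambdaCoef p n σ
    + ∑ l ∈ Finset.range (t - 1), deltaCoef p n M t l *
        ((1 - bCoef p M l t) ^ (t - l - 1) * lambdaCoef p n σ
          + ∑ j ∈ Finset.Icc 1 (t - l - 1), (1 - bCoef p M l t) ^ (t - l - 1 - j)
              * lambdaCoef p ((M : ℝ) / ((t : ℝ) - l - 1)) σ)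

/-- `c_i` (with final task `T`) for sequential rehearsal. -/
def c0Seq (p n M T i : ℕ) : ℝ := d0Seq p n M T - d0Seq p n M i

/-- `c_{ijk}` (with final task `T`) for sequential rehearsal. -/
def cSeq (p n M T i j k : ℕ) : ℝ := dSeq p n M i j k T - dSeq p n M i j k i

end

end Rehearsal

open Rehearsal

namespace Rehearsal

/-! ### Moments of the standard Gaussian vector and of its projections. -/

section GaussianMoments

open Module Filter Topology Real
open scoped ENNReal RealInnerProductSpace

/-! Every training step projects the current parameter onto the affine solution set of a fresh
Gaussian linear system. The expected errors therefore obey an affine recursion, which the stated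
coefficients solve.

One step: let `V` be the `N` samples, almost surely linearly independent, `v` the biorthogonal
family in their span, `d = w - x` the error before the step and `c a = ⟪V a, u a - x⟫ + z a` the
residuals at the reference point `x`. The new error is `d` minus its projection onto the span, plus
`∑ c a • v a`. These two parts are orthogonal, so its square is `‖d‖²`, minus the squared projection
of `d`, plus a quadratic form in `c` with matrix `⟪v a, v b⟫` (`norm_sq_add_sum_dualFamily`).

Taking expectations: rotation invariance makes every bilinear expectation a multiple of the inner
product (`bilin_eq_of_isometry_invariant`), so only traces are needed. The projection has trace `N`,
which gives the factor `1 - N / p`. On the diagonal of the quadratic form, `‖v a‖²` is the inverse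
squared length of `V a` off the other samples, an inverse chi-square with `p - N + 1` degrees of
freedom, of mean `1 / (p - N - 1)`. The off-diagonal traces follow from exchangeability and the
identity `∑ b, ⟪v a, v b⟫ * ⟪V a, V b⟫ = 1`. Polarization then gives
`integral_norm_sq_fitUpdate_sub`.

Fresh data are independent of the past, so the step can be iterated (`fit_datasets`). In concurrent
rehearsal all data of a task form one system, which creates the terms between different ground
truths. In sequential rehearsal each system has a single ground truth and those terms vanish. The
coefficients satisfy the same recursion because `bCoef` depends on `l` and `t` only through `t - l`:
passing from `t` to `t + 1` shifts the old summands and adds one at `l = 0`. -/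

lemma integral_exp_neg_mul_sq_gaussianReal {s : ℝ} (hs : 0 ≤ s) :
    ∫ x, rexp (-(s * x ^ 2)) ∂(gaussianReal 0 1) = (1 + 2 * s) ^ (-(1 / 2) : ℝ) := by
  rw [integral_gaussianReal_eq_integral_smul one_ne_zero]
  have h1 : ∀ x : ℝ, gaussianPDFReal 0 1 x • rexp (-(s * x ^ 2))
      = (√(2 * π))⁻¹ * rexp (-(s + 1 / 2) * x ^ 2) := by
    intro x
    simp only [gaussianPDFReal, NNReal.coe_one, mul_one, sub_zero, smul_eq_mul]
    rw [mul_assoc, ← Real.exp_add]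
    ring_nf
  simp_rw [h1]
  rw [integral_const_mul, integral_gaussian, Real.rpow_neg (by linarith), ← Real.sqrt_eq_rpow,
    ← Real.sqrt_inv, ← Real.sqrt_inv, ← Real.sqrt_mul (by positivity)]
  congr 1
  have : s + 1 / 2 ≠ 0 := by linarith
  have : 1 + 2 * s ≠ 0 := by linarith
  have := Real.pi_ne_zero
  field_simp
  ring

lemma lintegral_rpow_one_add_two_mul {k : ℝ} (hk : 0 < k) :
    ∫⁻ s in Set.Ioi (0 : ℝ), ENNReal.ofReal ((1 + 2 * s) ^ (-(k + 2) / 2))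
      = ENNReal.ofReal (1 / k) := by
  have hderiv : ∀ s ∈ Set.Ici (0 : ℝ), HasDerivAt (fun s : ℝ => -(1 / k) * (1 + 2 * s) ^ (-k / 2))
      ((1 + 2 * s) ^ (-(k + 2) / 2)) s := by
    intro s hs
    have hs' : (0 : ℝ) < 1 + 2 * s := by have : (0 : ℝ) ≤ s := hs; linarith
    have h1 : HasDerivAt (fun s : ℝ => 1 + 2 * s) 2 s := by
      simpa using ((hasDerivAt_id s).const_mul 2).const_add 1
    convert! (h1.rpow_const (p := -k / 2) (Or.inl hs'.ne')).const_mul (-(1 / k)) using 1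
    rw [show -k / 2 - 1 = -(k + 2) / 2 by ring]
    field_simp
  have hpos : ∀ s ∈ Set.Ioi (0 : ℝ), 0 ≤ (1 + 2 * s) ^ (-(k + 2) / 2) := by
    intro s hs
    have : (0 : ℝ) < s := hs
    positivity
  have htend : Tendsto (fun s : ℝ => -(1 / k) * (1 + 2 * s) ^ (-k / 2)) atTop (𝓝 0) := by
    have h1 : Tendsto (fun s : ℝ => 1 + 2 * s) atTop atTop :=
      tendsto_atTop_add_const_left _ _ (tendsto_id.const_mul_atTop two_pos)
    have h2 := ((tendsto_rpow_neg_atTop (half_pos hk)).comp h1).const_mul (-(1 / k))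
    simpa [neg_div, Function.comp_def] using h2
  have hint := integrableOn_Ioi_deriv_of_nonneg' hderiv hpos htend
  rw [← ofReal_integral_eq_lintegral_ofReal hint
    ((ae_restrict_mem measurableSet_Ioi).mono hpos),
    integral_Ioi_of_hasDerivAt_of_nonneg' hderiv hpos htend]
  simp

lemma lintegral_exp_neg_mul {r : ℝ} (hr : 0 < r) :
    ∫⁻ s in Set.Ioi (0 : ℝ), ENNReal.ofReal (rexp (-(s * r))) = ENNReal.ofReal r⁻¹ := by
  have h := integral_exp_mul_Ioi (a := -r) (by linarith) 0
  have hi := integrableOn_exp_mul_Ioi (a := -r) (by linarith) 0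
  simp_rw [show ∀ s, -(s * r) = -r * s by intro s; ring]
  rw [← ofReal_integral_eq_lintegral_ofReal hi (ae_of_all _ fun x => (Real.exp_pos _).le), h]
  simp [div_eq_mul_inv, inv_neg]

variable {F : Type*} [NormedAddCommGroup F] [InnerProductSpace ℝ F] [FiniteDimensional ℝ F]
  [MeasurableSpace F] [BorelSpace F]

lemma stdGaussian_map_inner (u : F) :
    (stdGaussian F).map (fun x => ⟪u, x⟫) = gaussianReal 0 (‖u‖₊ ^ 2) := by
  have h := IsGaussian.map_eq_gaussianReal (μ := stdGaussian F) (innerSL ℝ u)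
  rw [integral_strongDual_stdGaussian, variance_dual_stdGaussian, innerSL_apply_norm] at h
  convert! h using 2
  ext
  simp

/-- A proper subspace lies in a hyperplane `u⊥` with `u ≠ 0`, and `⟪u, x⟫` is a nondegenerate real
Gaussian, which has no atom at `0`. -/
lemma stdGaussian_submodule_eq_zero {K : Submodule ℝ F} (hK : K ≠ ⊤) :
    stdGaussian F (K : Set F) = 0 := by
  obtain ⟨u, hu, hu0⟩ := (Submodule.ne_bot_iff _).1
    (mt (Submodule.orthogonal_eq_bot_iff (K := K)).1 hK)
  have hsub : (K : Set F) ⊆ (fun x => ⟪u, x⟫) ⁻¹' {0} := fun x hx =>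
    Submodule.inner_left_of_mem_orthogonal hx hu
  refine measure_mono_null hsub ?_
  rw [← Measure.map_apply (by fun_prop) (measurableSet_singleton _), stdGaussian_map_inner]
  have := nullSingletonClass_gaussianReal (μ := 0) (v := ‖u‖₊ ^ 2) (by simpa using hu0)
  exact measure_singleton 0

lemma ae_stdGaussian_ne_zero (h : 0 < finrank ℝ F) : ∀ᵐ x ∂(stdGaussian F), x ≠ 0 := by
  have : Nontrivial F := finrank_pos_iff.1 h
  have h0 := stdGaussian_submodule_eq_zero (F := F) (K := ⊥) bot_ne_top
  rw [ae_iff]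
  simpa using h0

lemma integrable_inner_sq_stdGaussian (u : F) :
    Integrable (fun x => ⟪u, x⟫ ^ 2) (stdGaussian F) ∧
      ∫ x, ⟪u, x⟫ ^ 2 ∂(stdGaussian F) = ‖u‖ ^ 2 := by
  have hm : MemLp (fun x => ⟪u, x⟫) 2 (stdGaussian F) := by
    have h := IsGaussian.memLp_two_id (μ := gaussianReal 0 (‖u‖₊ ^ 2))
    rw [← stdGaussian_map_inner, memLp_map_measure_iff (by fun_prop) (by fun_prop)] at h
    exact h
  refine ⟨hm.integrable_sq, ?_⟩
  have hv := variance_dual_stdGaussian (innerSL ℝ u)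
  rw [variance_of_integral_eq_zero (by fun_prop) (integral_strongDual_stdGaussian _)] at hv
  simpa using hv

lemma lintegral_norm_sq_stdGaussian :
    ∫⁻ x, ENNReal.ofReal (‖x‖ ^ 2) ∂(stdGaussian F) = finrank ℝ F := by
  let b := stdOrthonormalBasis ℝ F
  simp_rw [← b.sum_sq_inner_right]
  rw [← ofReal_integral_eq_lintegral_ofReal
    (integrable_finsetSum _ fun i _ => (integrable_inner_sq_stdGaussian (b i)).1)
    (ae_of_all _ fun x => Finset.sum_nonneg fun i _ => sq_nonneg _),
    integral_finsetSum _ fun i _ => (integrable_inner_sq_stdGaussian (b i)).1]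
  simp [(integrable_inner_sq_stdGaussian _).2]

lemma lintegral_exp_neg_mul_norm_sq_stdGaussian {s : ℝ} (hs : 0 ≤ s) :
    ∫⁻ x, ENNReal.ofReal (rexp (-(s * ‖x‖ ^ 2))) ∂(stdGaussian F)
      = ENNReal.ofReal ((1 + 2 * s) ^ (-(finrank ℝ F : ℝ) / 2)) := by
  have hb : ∀ x : F, ‖rexp (-(s * ‖x‖ ^ 2))‖ ≤ 1 := fun x => by
    rw [Real.norm_eq_abs, abs_of_pos (Real.exp_pos _)]
    exact Real.exp_le_one_iff.2 (by have := mul_nonneg hs (sq_nonneg ‖x‖); linarith)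
  rw [← ofReal_integral_eq_lintegral_ofReal
    (Integrable.of_bound (by fun_prop) 1 (ae_of_all _ hb))
    (ae_of_all _ fun x => (Real.exp_pos _).le)]
  congr 1
  let b := stdOrthonormalBasis ℝ F
  rw [stdGaussian_eq_map_pi_orthonormalBasis b, integral_map
    (Finset.measurable_sum _ fun i _ => (measurable_pi_apply i).smul_const (b i)).aemeasurable
    (by fun_prop)]
  have hn : ∀ x : Fin (finrank ℝ F) → ℝ, rexp (-(s * ‖∑ i, x i • b i‖ ^ 2))
      = ∏ i, rexp (-(s * x i ^ 2)) := by
    intro x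
    rw [← Real.exp_sum, ← b.sum_sq_inner_right]
    simp [Finset.mul_sum, b.orthonormal.inner_right_fintype]
  simp_rw [hn]
  rw [integral_fintype_prod_eq_prod (fun _ x => rexp (-(s * x ^ 2)))]
  simp only [integral_exp_neg_mul_sq_gaussianReal hs, Finset.prod_const, Finset.card_univ,
    Fintype.card_fin]
  rw [← Real.rpow_natCast, ← Real.rpow_mul (by linarith)]
  congr 1
  ring

/-- Write the inverse of `r = ‖x‖²` as `∫ exp (-s r) ds` over `s > 0` and exchange the integrals.
The Laplace transform factorizes over coordinates into `(1 + 2 s) ^ (-k / 2)` with `k` the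
dimension, integrable exactly when `k > 2`. -/
lemma lintegral_inv_norm_sq_stdGaussian (h : 2 < finrank ℝ F) :
    ∫⁻ x, ENNReal.ofReal (‖x‖ ^ 2)⁻¹ ∂(stdGaussian F)
      = ENNReal.ofReal (1 / ((finrank ℝ F : ℝ) - 2)) := by
  have hk : (0 : ℝ) < (finrank ℝ F : ℝ) - 2 := by
    have : (2 : ℝ) < finrank ℝ F := by exact_mod_cast h
    linarith
  calc ∫⁻ x, ENNReal.ofReal (‖x‖ ^ 2)⁻¹ ∂(stdGaussian F)
      = ∫⁻ x, (∫⁻ s in Set.Ioi (0 : ℝ), ENNReal.ofReal (rexp (-(s * ‖x‖ ^ 2))))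
          ∂(stdGaussian F) := by
        refine lintegral_congr_ae ?_
        filter_upwards [ae_stdGaussian_ne_zero (F := F) (by omega)] with x hx
        exact (lintegral_exp_neg_mul (by positivity)).symm
    _ = ∫⁻ s in Set.Ioi (0 : ℝ), ∫⁻ x, ENNReal.ofReal (rexp (-(s * ‖x‖ ^ 2))) ∂(stdGaussian F) :=
        lintegral_lintegral_swap (by fun_prop)
    _ = ∫⁻ s in Set.Ioi (0 : ℝ), ENNReal.ofReal ((1 + 2 * s) ^ (-(finrank ℝ F : ℝ) / 2)) :=
        setLIntegral_congr_fun measurableSet_Ioi fun s hs =>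
          lintegral_exp_neg_mul_norm_sq_stdGaussian (le_of_lt hs)
    _ = _ := by
        rw [← lintegral_rpow_one_add_two_mul hk]
        simp

/-- The two components in an orthogonal decomposition are independent standard Gaussians: the
characteristic function depends only on the squared norm, which is additive over `K` and `Kᗮ`. -/
lemma stdGaussian_map_orthogonalProjection_prod (K : Submodule ℝ F) :
    (stdGaussian F).map
        (fun x => (K.orthogonalProjectionOnto x, Kᗮ.orthogonalProjectionOnto x))
      = (stdGaussian K).prod (stdGaussian Kᗮ) := by
  refine (MeasurableEquiv.toLp 2 (K × Kᗮ)).map_measurableEquiv_injective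
    (Measure.ext_of_charFun (funext fun t => ?_))
  rw [Measure.map_map (by fun_prop) (by fun_prop), MeasurableEquiv.coe_toLp, charFun_prod]
  have h : (WithLp.toLp 2 ∘ fun x =>
      (K.orthogonalProjectionOnto x, Kᗮ.orthogonalProjectionOnto x))
      = (K.orthogonalDecomposition : F → WithLp 2 (K × Kᗮ)) := by
    ext x : 1
    simp
  rw [h, stdGaussian_map, charFun_stdGaussian, charFun_stdGaussian, charFun_stdGaussian,
    ← Complex.ofReal_pow, WithLp.prod_norm_sq_eq_of_L2, ← Complex.exp_add]
  congr 1
  push_cast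
  change _ = -(‖t.fst‖ : ℂ) ^ 2 / 2 + -(‖t.snd‖ : ℂ) ^ 2 / 2
  ring

lemma lintegral_comp_orthogonalProjection (K : Submodule ℝ F) {f : K → ℝ≥0∞} {g : Kᗮ → ℝ≥0∞}
    (hf : Measurable f) (hg : Measurable g) :
    ∫⁻ x, f (K.orthogonalProjectionOnto x) * g (Kᗮ.orthogonalProjectionOnto x) ∂(stdGaussian F)
      = (∫⁻ x, f x ∂(stdGaussian K)) * ∫⁻ x, g x ∂(stdGaussian Kᗮ) := by
  rw [← lintegral_prod_mul hf.aemeasurable hg.aemeasurable,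
    ← stdGaussian_map_orthogonalProjection_prod, lintegral_map (by fun_prop) (by fun_prop)]

lemma lintegral_inv_norm_sq_starProjection {K : Submodule ℝ F} (h : 2 < finrank ℝ K) :
    ∫⁻ x, ENNReal.ofReal (‖K.starProjection x‖ ^ 2)⁻¹ ∂(stdGaussian F)
        = ENNReal.ofReal (1 / ((finrank ℝ K : ℝ) - 2)) := by
  have h1 := lintegral_comp_orthogonalProjection K
    (f := fun x => ENNReal.ofReal (‖x‖ ^ 2)⁻¹) (g := 1) (by fun_prop) (by fun_prop)
  rw [lintegral_inv_norm_sq_stdGaussian h] at h1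
  simpa using h1

/-- By Pythagoras the integrand is `1` plus a product of independent factors, one on `K` and one on
`Kᗮ`. With `k = dim K` and `m = dim F` this gives `1 + (m - k) / (k - 2)`. -/
lemma lintegral_inv_norm_sq_starProjection_mul_norm_sq {K : Submodule ℝ F}
    (h : 2 < finrank ℝ K) :
    ∫⁻ x, ENNReal.ofReal ((‖K.starProjection x‖ ^ 2)⁻¹ * ‖x‖ ^ 2) ∂(stdGaussian F)
        = ENNReal.ofReal (((finrank ℝ F : ℝ) - 2) / ((finrank ℝ K : ℝ) - 2)) := by
  have hk : (0 : ℝ) < (finrank ℝ K : ℝ) - 2 := by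
    have : (2 : ℝ) < finrank ℝ K := by exact_mod_cast h
    linarith
  -- With the convention `0⁻¹ = 0` the splitting below fails where the projection vanishes, so that
  -- null set is excluded first.
  have hne : ∀ᵐ x ∂(stdGaussian F), K.orthogonalProjectionOnto x ≠ 0 := by
    have h0 : stdGaussian F (Kᗮ : Set F) = 0 := by
      refine stdGaussian_submodule_eq_zero fun htop => ?_
      rw [Submodule.orthogonal_eq_top_iff] at htop
      rw [htop, finrank_bot] at h
      omega
    rw [ae_iff]
    simpa [Submodule.orthogonalProjectionOnto_eq_zero_iff] using h0
  have h1 := lintegral_comp_orthogonalProjection K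
    (f := fun x => ENNReal.ofReal (‖x‖ ^ 2)⁻¹) (g := fun x => ENNReal.ofReal (‖x‖ ^ 2))
    (by fun_prop) (by fun_prop)
  rw [lintegral_inv_norm_sq_stdGaussian h, lintegral_norm_sq_stdGaussian] at h1
  have h2 : ∀ᵐ x ∂(stdGaussian F), ENNReal.ofReal ((‖K.starProjection x‖ ^ 2)⁻¹ * ‖x‖ ^ 2)
      = 1 + ENNReal.ofReal (‖K.orthogonalProjectionOnto x‖ ^ 2)⁻¹
        * ENNReal.ofReal (‖Kᗮ.orthogonalProjectionOnto x‖ ^ 2) := by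
    filter_upwards [hne] with x hx
    have hx' : ‖K.orthogonalProjectionOnto x‖ ^ 2 ≠ 0 := pow_ne_zero 2 (norm_ne_zero_iff.2 hx)
    rw [← ENNReal.ofReal_mul (by positivity), ← ENNReal.ofReal_one,
      ← ENNReal.ofReal_add (by positivity) (by positivity),
      K.norm_sq_eq_add_norm_sq_projection x]
    congr 1
    rw [mul_add]
    congr 1
    exact inv_mul_cancel₀ hx'
  rw [lintegral_congr_ae h2, lintegral_add_left (by fun_prop), h1]
  simp only [lintegral_one, measure_univ]
  have hfin : (finrank ℝ K : ℝ) + finrank ℝ Kᗮ = finrank ℝ F := by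
    exact_mod_cast K.finrank_add_finrank_orthogonal
  rw [← ENNReal.ofReal_one, ← ENNReal.ofReal_natCast, ← ENNReal.ofReal_mul (by positivity),
    ← ENNReal.ofReal_add (by positivity) (by positivity), ← hfin]
  congr 1
  field_simp
  ring

end GaussianMoments

/-! ### Biorthogonal families: linear algebra and measurability. -/

section DualFamily

open Module
open scoped RealInnerProductSpace

variable {ι F : Type*} [Fintype ι] [DecidableEq ι] [NormedAddCommGroup F] [InnerProductSpace ℝ F]

/-- The family in the span of `V` that is biorthogonal to `V`, if `V` is linearly independent. -/
noncomputable def dualFamily (V : ι → F) (a : ι) : F := ∑ b, (Matrix.gram ℝ V)⁻¹ a b • V b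

lemma isUnit_det_gram {V : ι → F} (hV : LinearIndependent ℝ V) :
    IsUnit (Matrix.gram ℝ V).det :=
  isUnit_iff_ne_zero.2 (Matrix.det_gram_ne_zero_iff_linearIndependent.2 hV)

lemma inner_dualFamily {V : ι → F} (hV : LinearIndependent ℝ V) (a b : ι) :
    ⟪dualFamily V a, V b⟫ = if a = b then 1 else 0 := by
  have h := congrFun (congrFun (Matrix.nonsing_inv_mul _ (isUnit_det_gram hV)) a) b
  rw [Matrix.mul_apply, Matrix.one_apply] at h
  rw [← h, dualFamily, sum_inner]
  simp [inner_smul_left]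

lemma dualFamily_mem_span (V : ι → F) (a : ι) :
    dualFamily V a ∈ Submodule.span ℝ (Set.range V) :=
  Submodule.sum_mem _ fun b _ =>
    Submodule.smul_mem _ _ (Submodule.subset_span (Set.mem_range_self b))

/-- The Gram matrix of the dual family is the inverse Gram matrix of `V`, so summing its row against
`V b` rebuilds the dual vector. -/
lemma sum_inner_dualFamily_mul_inner {V : ι → F} (hV : LinearIndependent ℝ V) (a : ι) (d : F) :
    ∑ b, ⟪dualFamily V a, dualFamily V b⟫ * ⟪V b, d⟫ = ⟪dualFamily V a, d⟫ := by
  have h : ∀ b, ⟪dualFamily V a, dualFamily V b⟫ = (Matrix.gram ℝ V)⁻¹ a b := by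
    intro b
    rw [real_inner_comm]
    change ⟪dualFamily V b, ∑ c, (Matrix.gram ℝ V)⁻¹ a c • V c⟫ = _
    simp [inner_sum, inner_smul_right, inner_dualFamily hV]
  simp_rw [h]
  rw [dualFamily, sum_inner]
  simp [inner_smul_left]

lemma dualFamily_comp_linearIsometryEquiv (U : F ≃ₗᵢ[ℝ] F) (V : ι → F) (a : ι) :
    dualFamily (fun b => U (V b)) a = U (dualFamily V a) := by
  have h : Matrix.gram ℝ (fun b => U (V b)) = Matrix.gram ℝ V := by
    ext; simp
  simp [dualFamily, h]

lemma dualFamily_comp_perm (e : Equiv.Perm ι) (V : ι → F) (a : ι) :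
    dualFamily (V ∘ e) a = dualFamily V (e a) := by
  have h : Matrix.gram ℝ (V ∘ e) = (Matrix.gram ℝ V).submatrix e e := rfl
  rw [dualFamily, h, Matrix.inv_submatrix_equiv, dualFamily]
  exact Equiv.sum_comp e fun b => (Matrix.gram ℝ V)⁻¹ (e a) b • V b

/-- `‖w' - w*‖ ^ 2` for the update `w'` splits into a part that depends on the error `d` before the
update and a part that depends on the residuals `c` at `w*`. -/
lemma norm_sq_add_sum_dualFamily {V : ι → F} (hV : LinearIndependent ℝ V) (d : F) (c : ι → ℝ) :
    ‖d + ∑ a, (c a - ⟪V a, d⟫) • dualFamily V a‖ ^ 2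
      = (‖d‖ ^ 2 - ∑ a, ⟪V a, d⟫ * ⟪dualFamily V a, d⟫)
        + ∑ a, ∑ b, c a * c b * ⟪dualFamily V a, dualFamily V b⟫ := by
  have h1 : ∀ a, ∑ b, (c a - ⟪V a, d⟫) * ((c b - ⟪V b, d⟫) * ⟪dualFamily V a, dualFamily V b⟫)
      = c a * (∑ b, c b * ⟪dualFamily V a, dualFamily V b⟫) - c a * ⟪dualFamily V a, d⟫
        - (∑ b, ⟪V a, d⟫ * c b * ⟪dualFamily V a, dualFamily V b⟫)
        + ⟪V a, d⟫ * ⟪dualFamily V a, d⟫ := by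
    intro a
    rw [← sum_inner_dualFamily_mul_inner hV a d, Finset.mul_sum, Finset.mul_sum, Finset.mul_sum,
      ← Finset.sum_sub_distrib, ← Finset.sum_sub_distrib, ← Finset.sum_add_distrib]
    exact Finset.sum_congr rfl fun b _ => by ring
  have h2 : ∑ a, ∑ b, ⟪V a, d⟫ * c b * ⟪dualFamily V a, dualFamily V b⟫
      = ∑ b, c b * ⟪dualFamily V b, d⟫ := by
    rw [Finset.sum_comm]
    refine Finset.sum_congr rfl fun b _ => ?_
    rw [← sum_inner_dualFamily_mul_inner hV b d, Finset.mul_sum]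
    exact Finset.sum_congr rfl fun a _ => by
      rw [real_inner_comm (dualFamily V a) (dualFamily V b)]; ring
  rw [norm_add_sq_real, ← real_inner_self_eq_norm_sq (∑ a, _), sum_inner]
  simp_rw [inner_sum, real_inner_smul_left, real_inner_smul_right, h1]
  rw [Finset.sum_add_distrib, Finset.sum_sub_distrib, Finset.sum_sub_distrib, h2]
  -- Twice this sum is the mixed term of the square. Its part linear in `c` cancels the one from the
  -- norm of the correction, and one copy of the squared projection of `d` remains with a minus
  -- sign.
  have h3 : ∑ a, (c a - ⟪V a, d⟫) * ⟪d, dualFamily V a⟫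
      = ∑ a, c a * ⟪dualFamily V a, d⟫ - ∑ a, ⟪V a, d⟫ * ⟪dualFamily V a, d⟫ := by
    rw [← Finset.sum_sub_distrib]
    exact Finset.sum_congr rfl fun a _ => by rw [real_inner_comm (dualFamily V a) d]; ring
  simp_rw [h3, Finset.mul_sum, mul_assoc]
  ring

/-- The biorthogonal vectors of a family in terms of the projections off the other members. -/
lemma norm_dualFamily_sq {V : ι → F} [FiniteDimensional ℝ F] (hV : LinearIndependent ℝ V) (a : ι)
    {K : Submodule ℝ F} (hK : K = Submodule.span ℝ (Set.range fun b : {b // b ≠ a} => V b)) :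
    ‖dualFamily V a‖ ^ 2 = (‖Kᗮ.starProjection (V a)‖ ^ 2)⁻¹ := by
  set v := dualFamily V a
  set q := Kᗮ.starProjection (V a)
  have hvK : v ∈ Kᗮ := by
    rw [hK, Submodule.mem_orthogonal']
    intro u hu
    induction hu using Submodule.span_induction with
    | mem x hx => obtain ⟨b, rfl⟩ := hx; rw [inner_dualFamily hV, if_neg b.2.symm]
    | zero => simp
    | add x y _ _ hx hy => rw [inner_add_right, hx, hy, add_zero]
    | smul c x _ hx => rw [inner_smul_right, hx, mul_zero]
  have hvq : ⟪v, q⟫ = 1 := by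
    rw [← Submodule.inner_starProjection_left_eq_right, Submodule.starProjection_eq_self_iff.2 hvK,
      inner_dualFamily hV, if_pos rfl]
  -- The dual vector lies both in the span of `V` and in `Kᗮ`. Projecting its expansion onto `Kᗮ`
  -- kills every term except the one at `a`.
  have hqv : ∃ c : ℝ, v = c • q := by
    obtain ⟨f, hf⟩ := (Submodule.mem_span_range_iff_exists_fun ℝ).1 (dualFamily_mem_span V a)
    refine ⟨f a, ?_⟩
    have h1 : Kᗮ.starProjection v = f a • q := by
      have hzero : ∀ b, b ≠ a → Kᗮ.starProjection (V b) = 0 := fun b hb => by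
        rw [Submodule.starProjection_apply_eq_zero_iff, Submodule.orthogonal_orthogonal, hK]
        exact Submodule.subset_span ⟨⟨b, hb⟩, rfl⟩
      change _ = v at hf
      rw [← hf, map_sum, Finset.sum_eq_single a (fun b _ hb => by rw [map_smul, hzero b hb,
        smul_zero]) (by simp), map_smul]
    rw [← h1, Submodule.starProjection_eq_self_iff.2 hvK]
  obtain ⟨c, hc⟩ := hqv
  have h2 : c * ‖q‖ ^ 2 = 1 := by
    rw [hc, real_inner_smul_left, real_inner_self_eq_norm_sq] at hvq
    exact hvq
  have hq0 : ‖q‖ ^ 2 ≠ 0 := right_ne_zero_of_mul_eq_one h2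
  rw [hc, norm_smul, mul_pow, Real.norm_eq_abs, sq_abs, eq_inv_of_mul_eq_one_left h2]
  field_simp

omit [Fintype ι] in
lemma linearIndependent_of_notMem_span {V : ι → F} (a : ι)
    (h1 : LinearIndependent ℝ fun b : {b // b ≠ a} => V b)
    (h2 : V a ∉ Submodule.span ℝ (Set.range fun b : {b // b ≠ a} => V b)) :
    LinearIndependent ℝ V := by
  rw [← linearIndependent_equiv (Equiv.optionSubtypeNe a), linearIndependent_option]
  exact ⟨by simpa [Function.comp_def] using h1, by simpa [Function.comp_def] using h2⟩

variable [MeasurableSpace F] [BorelSpace F] [FiniteDimensional ℝ F]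

omit [DecidableEq ι] [Fintype ι] [MeasurableSpace F] [BorelSpace F] [FiniteDimensional ℝ F] in
lemma continuous_gram : Continuous fun V : ι → F => Matrix.gram ℝ V :=
  continuous_matrix fun i j => by simp only [Matrix.gram_apply]; fun_prop

/-- The inverse matrix is the inverse determinant times the adjugate, so measurability holds on all
families, degenerate ones included. -/
lemma measurable_dualFamily (a : ι) : Measurable fun V : ι → F => dualFamily V a := by
  refine Finset.measurable_sum _ fun b _ => Measurable.smul ?_ (measurable_pi_apply b)
  simp_rw [Matrix.inv_def, Matrix.smul_apply, Ring.inverse_eq_inv', smul_eq_mul]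
  exact (continuous_gram.matrix_det.measurable.inv).mul
    ((continuous_gram.matrix_adjugate.matrix_elem a b).measurable)

lemma measurableSet_linearIndependent :
    MeasurableSet {V : ι → F | LinearIndependent ℝ V} := by
  simp_rw [← Matrix.det_gram_ne_zero_iff_linearIndependent]
  exact continuous_gram.matrix_det.measurable (measurableSet_singleton (0 : ℝ)).compl

end DualFamily

/-! ### Families of independent Gaussian vectors, conditioned on all members but one. -/

section GaussianFamily

open Module
open scoped RealInnerProductSpace ENNReal

universe u v

variable {ι : Type u} {F : Type v} [Fintype ι] [DecidableEq ι] [NormedAddCommGroup F]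
  [InnerProductSpace ℝ F] [FiniteDimensional ℝ F] [MeasurableSpace F] [BorelSpace F]

variable (ι F) in
/-- The law of a family of independent standard Gaussian vectors. -/
noncomputable def gaussianFamily : Measure (ι → F) := Measure.pi fun _ => stdGaussian F

instance : IsProbabilityMeasure (gaussianFamily ι F) := by
  unfold gaussianFamily; infer_instance

/-- The family with value `x` at `a` and the values of `W` elsewhere. -/
def insertAt (a : ι) (x : F) (W : {b // b ≠ a} → F) (b : ι) : F :=
  if h : b = a then x else W ⟨b, h⟩

omit [Fintype ι] [NormedAddCommGroup F] [InnerProductSpace ℝ F] [FiniteDimensional ℝ F]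
  [MeasurableSpace F] [BorelSpace F] in
@[simp] lemma insertAt_self (a : ι) (x : F) (W : {b // b ≠ a} → F) : insertAt a x W a = x := by
  simp [insertAt]

omit [Fintype ι] [NormedAddCommGroup F] [InnerProductSpace ℝ F] [FiniteDimensional ℝ F]
  [MeasurableSpace F] [BorelSpace F] in
@[simp] lemma insertAt_coe (a : ι) (x : F) (W : {b // b ≠ a} → F) (b : {b // b ≠ a}) :
    insertAt a x W b = W b := by
  simp [insertAt, b.2]

lemma measurePreserving_insertAt (a : ι) :
    MeasurePreserving (fun q : F × ({b // b ≠ a} → F) => insertAt a q.1 q.2)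
      ((stdGaussian F).prod (gaussianFamily {b // b ≠ a} F)) (gaussianFamily ι F) := by
  have h1 := (measurePreserving_piEquivPiSubtypeProd (fun _ : ι => stdGaussian F)
    (fun b => b = a)).symm
  have h2 := ((measurePreserving_funUnique (stdGaussian F) {b // b = a}).symm).prod
    (MeasurePreserving.id (gaussianFamily {b // b ≠ a} F))
  -- The product measure on the one-element index type depends on its `Fintype` instance, so the two
  -- instances in play are identified.
  rw [Subsingleton.elim (Unique.fintype : Fintype {b // b = a}) (Subtype.fintype _)] at h2
  have h3 := h1.comp h2
  refine ⟨?_, ?_⟩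
  · refine measurable_pi_lambda _ fun b => ?_
    by_cases h : b = a <;> simp [insertAt, h] <;> fun_prop
  · exact h3.map_eq

lemma lintegral_gaussianFamily (a : ι) {f : (ι → F) → ℝ≥0∞} (hf : Measurable f) :
    ∫⁻ V, f V ∂(gaussianFamily ι F)
      = ∫⁻ W, ∫⁻ x, f (insertAt a x W) ∂(stdGaussian F) ∂(gaussianFamily {b // b ≠ a} F) := by
  have hm := measurePreserving_insertAt (F := F) a
  rw [← hm.lintegral_comp hf, 
    lintegral_prod_symm (fun q : F × ({b // b ≠ a} → F) => f (insertAt a q.1 q.2))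
      (hf.comp hm.measurable).aemeasurable]

/-- Induction on the number of vectors: fewer than `finrank ℝ F` vectors span a proper subspace,
which the next independent vector avoids almost surely. -/
lemma ae_linearIndependent_gaussianFamily (h : Fintype.card ι ≤ finrank ℝ F) :
    ∀ᵐ V ∂(gaussianFamily ι F), LinearIndependent ℝ V := by
  induction hN : Fintype.card ι generalizing ι with
  | zero =>
    have := Fintype.card_eq_zero_iff.1 hN
    exact ae_of_all _ fun V => linearIndependent_empty_type
  | succ N ih =>
    obtain ⟨a⟩ : Nonempty ι := Fintype.card_pos_iff.1 (by omega)
    have hcard : Fintype.card {b // b ≠ a} = N := by simp [hN]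
    have hs : MeasurableSet {V : ι → F | ¬LinearIndependent ℝ V} :=
      measurableSet_linearIndependent.compl
    rw [ae_iff, ← lintegral_indicator_one hs, lintegral_gaussianFamily a
      (measurable_one.indicator hs)]
    refine (lintegral_congr_ae (g := 0) ?_).trans lintegral_zero
    filter_upwards [ih (ι := {b // b ≠ a}) (by omega) hcard] with W hW
    have hK : Submodule.span ℝ (Set.range W) ≠ ⊤ := fun htop => by
      have h1 := finrank_range_le_card (R := ℝ) W
      rw [Set.finrank, htop, finrank_top] at h1
      omega
    have h0 := stdGaussian_submodule_eq_zero hK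
    refine le_antisymm ?_ zero_le
    calc _ ≤ ∫⁻ x, (Submodule.span ℝ (Set.range W) : Set F).indicator 1 x ∂(stdGaussian F) := by
          refine lintegral_mono fun x => ?_
          by_cases hx : x ∈ Submodule.span ℝ (Set.range W)
          · rw [Set.indicator_of_mem (show x ∈ (_ : Set F) from hx)]
            exact Set.indicator_le_self _ _ _
          · rw [Set.indicator_of_notMem]
            · exact zero_le
            · simp only [Set.mem_ofPred_eq, not_not]
              exact linearIndependent_of_notMem_span a (by simpa using hW) (by simpa using hx)
      _ = 0 := by
        rw [lintegral_indicator_one (Submodule.closed_of_finiteDimensional _).measurableSet, h0]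

/-- Conditionally on the other vectors, `norm_dualFamily_sq` reduces to the projection of one
Gaussian vector onto the orthogonal complement `K` of their span. Almost surely `finrank ℝ K - 2` is
`finrank ℝ F - card ι - 1`, so the hypothesis is what makes the inverse moment finite. -/
lemma lintegral_norm_dualFamily (h : Fintype.card ι + 1 < finrank ℝ F) (a : ι) :
    ∫⁻ V, ENNReal.ofReal (‖dualFamily V a‖ ^ 2) ∂(gaussianFamily ι F)
        = ENNReal.ofReal (1 / ((finrank ℝ F : ℝ) - Fintype.card ι - 1)) ∧
      ∫⁻ V, ENNReal.ofReal (‖dualFamily V a‖ ^ 2 * ‖V a‖ ^ 2) ∂(gaussianFamily ι F)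
        = ENNReal.ofReal (((finrank ℝ F : ℝ) - 2) / ((finrank ℝ F : ℝ) - Fintype.card ι - 1)) := by
  have hcard : 0 < Fintype.card ι := Fintype.card_pos_iff.2 ⟨a⟩
  have hcard' : Fintype.card {b // b ≠ a} = Fintype.card ι - 1 := by simp
  have hd := measurable_dualFamily (F := F) a
  have key : ∀ᵐ W ∂(gaussianFamily {b // b ≠ a} F), ∃ K : Submodule ℝ F,
      (finrank ℝ K = finrank ℝ F - Fintype.card ι + 1) ∧
      ∀ᵐ x ∂(stdGaussian F), ‖dualFamily (insertAt a x W) a‖ ^ 2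
        = (‖K.starProjection x‖ ^ 2)⁻¹ := by
    filter_upwards [ae_linearIndependent_gaussianFamily (ι := {b // b ≠ a}) (F := F) (by omega)]
      with W hW
    refine ⟨(Submodule.span ℝ (Set.range W))ᗮ, ?_, ?_⟩
    · have h1 := (Submodule.span ℝ (Set.range W)).finrank_add_finrank_orthogonal
      rw [finrank_span_eq_card hW] at h1
      omega
    · have hK : Submodule.span ℝ (Set.range W) ≠ ⊤ := fun htop => by
        have h1 := finrank_range_le_card (R := ℝ) W
        rw [Set.finrank, htop, finrank_top] at h1
        omega
      have h0 := stdGaussian_submodule_eq_zero hK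
      filter_upwards [measure_eq_zero_iff_ae_notMem.1 h0] with x hx
      have hV : LinearIndependent ℝ (insertAt a x W) :=
        linearIndependent_of_notMem_span a (by simpa using hW) (by simpa using hx)
      simpa using norm_dualFamily_sq hV a (K := Submodule.span ℝ (Set.range W)) (by simp)
  have hr : ∀ K : Submodule ℝ F, finrank ℝ K = finrank ℝ F - Fintype.card ι + 1 →
      (finrank ℝ K : ℝ) - 2 = (finrank ℝ F : ℝ) - Fintype.card ι - 1 := by
    intro K hK
    rw [hK, Nat.cast_add, Nat.cast_sub (by omega)]
    push_cast
    ring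
  constructor
  · rw [lintegral_gaussianFamily a (by fun_prop)]
    have h1 : ∀ᵐ W ∂(gaussianFamily {b // b ≠ a} F),
        ∫⁻ x, ENNReal.ofReal (‖dualFamily (insertAt a x W) a‖ ^ 2) ∂(stdGaussian F)
          = ENNReal.ofReal (1 / ((finrank ℝ F : ℝ) - Fintype.card ι - 1)) := by
      filter_upwards [key] with W ⟨K, hK, hW⟩
      rw [lintegral_congr_ae (hW.mono fun x hx => congrArg ENNReal.ofReal hx),
        lintegral_inv_norm_sq_starProjection (by omega), hr K hK]
    rw [lintegral_congr_ae h1]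
    simp
  · rw [lintegral_gaussianFamily a (by fun_prop)]
    have h1 : ∀ᵐ W ∂(gaussianFamily {b // b ≠ a} F),
        ∫⁻ x, ENNReal.ofReal (‖dualFamily (insertAt a x W) a‖ ^ 2 * ‖insertAt a x W a‖ ^ 2)
            ∂(stdGaussian F)
          = ENNReal.ofReal (((finrank ℝ F : ℝ) - 2) / ((finrank ℝ F : ℝ) - Fintype.card ι - 1)) := by
      filter_upwards [key] with W ⟨K, hK, hW⟩
      simp only [insertAt_self]
      rw [lintegral_congr_ae (hW.mono fun x hx => congrArg ENNReal.ofReal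
          (congrArg (· * ‖x‖ ^ 2) hx)),
        lintegral_inv_norm_sq_starProjection_mul_norm_sq (by omega), hr K hK]
    rw [lintegral_congr_ae h1]
    simp

end GaussianFamily

/-! ### Isometry-invariant bilinear forms. -/

section Isotropic

open Module
open scoped RealInnerProductSpace

variable {F : Type*} [NormedAddCommGroup F] [InnerProductSpace ℝ F] [FiniteDimensional ℝ F]

/-- A bilinear form that is invariant under all linear isometries is a multiple of the inner
product. -/
lemma bilin_eq_of_isometry_invariant (A : LinearMap.BilinForm ℝ F)
    (hA : ∀ (U : F ≃ₗᵢ[ℝ] F) (u v : F), A (U u) (U v) = A u v) (u v : F) :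
    A u v = (∑ i, A (stdOrthonormalBasis ℝ F i) (stdOrthonormalBasis ℝ F i)) / finrank ℝ F
      * ⟪u, v⟫ := by
  -- The reflection in the hyperplane `v⊥` fixes `u` and negates `v`, hence `A u v = -A u v`.
  have horth : ∀ u v : F, ⟪u, v⟫ = 0 → A u v = 0 := by
    intro u v huv
    have h1 := hA (ℝ ∙ v)ᗮ.reflection u v
    rw [Submodule.reflection_orthogonalComplement_singleton_eq_neg,
      Submodule.reflection_mem_subspace_eq_self
        (Submodule.mem_orthogonal_singleton_iff_inner_left.2 huv), map_neg] at h1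
    linarith
  -- For vectors of equal norm, the reflection in the hyperplane orthogonal to `u - v` sends `u` to
  -- `v`.
  have hnorm : ∀ u v : F, ‖u‖ = ‖v‖ → A u u = A v v := by
    intro u v huv
    rw [← hA (ℝ ∙ (u - v))ᗮ.reflection u u, Submodule.reflection_sub huv]
  set b := stdOrthonormalBasis ℝ F
  have hconst : ∀ i j, A (b i) (b j)
      = if i = j then (∑ k, A (b k) (b k)) / finrank ℝ F else 0 := by
    intro i j
    split_ifs with h
    · subst h
      have h1 : ∀ k, A (b k) (b k) = A (b i) (b i) := fun k =>
        hnorm _ _ (by rw [b.norm_eq_one, b.norm_eq_one])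
      have hpos : (finrank ℝ F : ℝ) ≠ 0 := by
        have := i.pos
        positivity
      simp only [h1, Finset.sum_const, Finset.card_univ, Fintype.card_fin, nsmul_eq_mul]
      field_simp
    · exact horth _ _ (b.inner_eq_zero h)
  generalize (∑ k, A (b k) (b k)) / (finrank ℝ F : ℝ) = c at hconst ⊢
  conv_lhs => rw [← b.sum_repr' u, ← b.sum_repr' v]
  simp only [map_sum, LinearMap.sum_apply, map_smul, LinearMap.smul_apply, hconst, smul_eq_mul,
    mul_ite, mul_zero, Finset.sum_ite_eq', Finset.mem_univ, if_true]
  rw [← b.sum_inner_mul_inner u v, Finset.mul_sum]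
  refine Finset.sum_congr rfl fun i _ => ?_
  rw [real_inner_comm (b i) u]
  ring

end Isotropic

/-! ### Joint moments of a Gaussian family and its biorthogonal family. -/

section GaussianFamilyMoments

open Module
open scoped RealInnerProductSpace ENNReal

universe u v

variable {ι : Type u} {F : Type v} [Fintype ι] [DecidableEq ι] [NormedAddCommGroup F]
  [InnerProductSpace ℝ F] [FiniteDimensional ℝ F] [MeasurableSpace F] [BorelSpace F]

attribute [fun_prop] measurable_dualFamily

omit [DecidableEq ι] in
lemma measurePreserving_linearIsometryEquiv (U : F ≃ₗᵢ[ℝ] F) :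
    MeasurePreserving (fun (V : ι → F) a => U (V a)) (gaussianFamily ι F) (gaussianFamily ι F) :=
  measurePreserving_pi _ _ fun _ => ⟨by fun_prop, stdGaussian_map U⟩

omit [DecidableEq ι] in
lemma measurePreserving_perm (e : Equiv.Perm ι) :
    MeasurePreserving (fun V : ι → F => V ∘ e) (gaussianFamily ι F) (gaussianFamily ι F) := by
  have h := measurePreserving_piCongrLeft (fun _ : ι => stdGaussian F) e.symm
  convert! h using 1
  ext V a
  obtain ⟨b, rfl⟩ := e.symm.surjective a
  simp [MeasurableEquiv.coe_piCongrLeft, Equiv.piCongrLeft_apply_apply]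

lemma integrable_of_lintegral_ofReal_eq {α : Type*} [MeasurableSpace α] {μ : Measure α} {f : α → ℝ}
    {c : ℝ} (hc : 0 ≤ c) (hf : AEStronglyMeasurable f μ) (h0 : ∀ x, 0 ≤ f x)
    (h : ∫⁻ x, ENNReal.ofReal (f x) ∂μ = ENNReal.ofReal c) :
    Integrable f μ ∧ ∫ x, f x ∂μ = c := by
  refine ⟨⟨hf, ?_⟩, ?_⟩
  · rw [hasFiniteIntegral_iff_ofReal (ae_of_all _ h0), h]
    exact ENNReal.ofReal_lt_top
  · rw [integral_eq_lintegral_of_nonneg_ae (ae_of_all _ h0) hf, h, ENNReal.toReal_ofReal hc]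

variable (h : Fintype.card ι + 1 < finrank ℝ F)

include h

omit [DecidableEq ι] [FiniteDimensional ℝ F] [MeasurableSpace F] [BorelSpace F] in
lemma finrank_sub_card_sub_one_pos : (0 : ℝ) < (finrank ℝ F : ℝ) - Fintype.card ι - 1 := by
  have : (Fintype.card ι : ℝ) + 1 < finrank ℝ F := by exact_mod_cast h
  linarith

lemma integral_norm_sq_dualFamily (a : ι) :
    Integrable (fun V => ‖dualFamily V a‖ ^ 2) (gaussianFamily ι F) ∧
      ∫ V, ‖dualFamily V a‖ ^ 2 ∂(gaussianFamily ι F)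
        = 1 / ((finrank ℝ F : ℝ) - Fintype.card ι - 1) :=
  integrable_of_lintegral_ofReal_eq (one_div_nonneg.2 (finrank_sub_card_sub_one_pos h).le)
    (Measurable.aestronglyMeasurable (by fun_prop)) (fun _ => sq_nonneg _)
    (lintegral_norm_dualFamily h a).1

lemma integral_norm_sq_dualFamily_mul_norm_sq (a : ι) :
    Integrable (fun V => ‖dualFamily V a‖ ^ 2 * ‖V a‖ ^ 2) (gaussianFamily ι F) ∧
      ∫ V, ‖dualFamily V a‖ ^ 2 * ‖V a‖ ^ 2 ∂(gaussianFamily ι F)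
        = ((finrank ℝ F : ℝ) - 2) / ((finrank ℝ F : ℝ) - Fintype.card ι - 1) := by
  have h1 := finrank_sub_card_sub_one_pos h
  have h2 : (1 : ℝ) ≤ Fintype.card ι := by exact_mod_cast Fintype.card_pos_iff.2 ⟨a⟩
  exact integrable_of_lintegral_ofReal_eq (div_nonneg (by linarith) h1.le)
    (Measurable.aestronglyMeasurable (by fun_prop)) (fun _ => by positivity)
    (lintegral_norm_dualFamily h a).2

/-- This and the following integrability results use Cauchy–Schwarz and `2xy ≤ x² + y²` to dominate
each mixed moment by the two explicit moments `‖v a‖²` and `‖v a‖² * ‖V a‖²`, plus a constant where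
needed. -/
lemma integrable_inner_dualFamily (a b : ι) :
    Integrable (fun V => ⟪dualFamily V a, dualFamily V b⟫) (gaussianFamily ι F) := by
  refine ((integral_norm_sq_dualFamily h a).1.add (integral_norm_sq_dualFamily h b).1).mono'
    (Measurable.aestronglyMeasurable (by fun_prop)) (ae_of_all _ fun V => ?_)
  refine (norm_inner_le_norm _ _).trans ?_
  simp only [Pi.add_apply]
  nlinarith [sq_nonneg (‖dualFamily V a‖ - ‖dualFamily V b‖), sq_nonneg ‖dualFamily V a‖,
    sq_nonneg ‖dualFamily V b‖]

lemma integrable_inner_dualFamily_mul_inner (a b : ι) (u : F) :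
    Integrable (fun V => ⟪dualFamily V a, dualFamily V b⟫ * ⟪V a, u⟫) (gaussianFamily ι F) := by
  refine (((integral_norm_sq_dualFamily_mul_norm_sq h a).1.add
    (integral_norm_sq_dualFamily h b).1).const_mul ‖u‖).mono'
    (Measurable.aestronglyMeasurable (by fun_prop)) (ae_of_all _ fun V => ?_)
  rw [norm_mul]
  have h1 := mul_le_mul (norm_inner_le_norm (𝕜 := ℝ) (dualFamily V a) (dualFamily V b))
    (norm_inner_le_norm (𝕜 := ℝ) (V a) u) (norm_nonneg _) (by positivity)
  refine h1.trans ?_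
  simp only [Pi.add_apply]
  have h2 : ‖dualFamily V a‖ * ‖V a‖ * ‖dualFamily V b‖
      ≤ ‖dualFamily V a‖ ^ 2 * ‖V a‖ ^ 2 + ‖dualFamily V b‖ ^ 2 := by
    nlinarith [sq_nonneg (‖dualFamily V a‖ * ‖V a‖ - ‖dualFamily V b‖),
      sq_nonneg (‖dualFamily V a‖ * ‖V a‖), sq_nonneg ‖dualFamily V b‖]
  calc _ = ‖u‖ * (‖dualFamily V a‖ * ‖V a‖ * ‖dualFamily V b‖) := by ring
    _ ≤ _ := mul_le_mul_of_nonneg_left h2 (norm_nonneg _)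

lemma integrable_inner_dualFamily_mul_inner_mul_inner (a b : ι) (u v : F) :
    Integrable (fun V => ⟪dualFamily V a, dualFamily V b⟫ * (⟪V a, u⟫ * ⟪V b, v⟫))
      (gaussianFamily ι F) := by
  refine (((integral_norm_sq_dualFamily_mul_norm_sq h a).1.add
    (integral_norm_sq_dualFamily_mul_norm_sq h b).1).const_mul (‖u‖ * ‖v‖)).mono'
    (Measurable.aestronglyMeasurable (by fun_prop)) (ae_of_all _ fun V => ?_)
  rw [norm_mul, norm_mul]
  have h1 := mul_le_mul (norm_inner_le_norm (𝕜 := ℝ) (dualFamily V a) (dualFamily V b))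
    (mul_le_mul (norm_inner_le_norm (𝕜 := ℝ) (V a) u) (norm_inner_le_norm (𝕜 := ℝ) (V b) v)
      (norm_nonneg _) (by positivity)) (by positivity) (by positivity)
  refine h1.trans ?_
  simp only [Pi.add_apply]
  have h2 : (‖dualFamily V a‖ * ‖V a‖) * (‖dualFamily V b‖ * ‖V b‖)
      ≤ ‖dualFamily V a‖ ^ 2 * ‖V a‖ ^ 2 + ‖dualFamily V b‖ ^ 2 * ‖V b‖ ^ 2 := by
    nlinarith [sq_nonneg (‖dualFamily V a‖ * ‖V a‖ - ‖dualFamily V b‖ * ‖V b‖),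
      sq_nonneg (‖dualFamily V a‖ * ‖V a‖), sq_nonneg (‖dualFamily V b‖ * ‖V b‖)]
  calc _ = ‖u‖ * ‖v‖ * ((‖dualFamily V a‖ * ‖V a‖) * (‖dualFamily V b‖ * ‖V b‖)) := by ring
    _ ≤ _ := mul_le_mul_of_nonneg_left h2 (by positivity)

lemma integrable_inner_mul_inner_dualFamily (a : ι) (u v : F) :
    Integrable (fun V => ⟪V a, u⟫ * ⟪dualFamily V a, v⟫) (gaussianFamily ι F) := by
  refine (((integral_norm_sq_dualFamily_mul_norm_sq h a).1.add
    (integrable_const 1)).const_mul (‖u‖ * ‖v‖)).mono'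
    (Measurable.aestronglyMeasurable (by fun_prop)) (ae_of_all _ fun V => ?_)
  rw [norm_mul]
  have h1 := mul_le_mul (norm_inner_le_norm (𝕜 := ℝ) (V a) u)
    (norm_inner_le_norm (𝕜 := ℝ) (dualFamily V a) v) (norm_nonneg _) (by positivity)
  refine h1.trans ?_
  simp only [Pi.add_apply]
  have h2 : ‖dualFamily V a‖ * ‖V a‖ ≤ ‖dualFamily V a‖ ^ 2 * ‖V a‖ ^ 2 + 1 := by
    nlinarith [sq_nonneg (‖dualFamily V a‖ * ‖V a‖ - 1), sq_nonneg (‖dualFamily V a‖ * ‖V a‖)]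
  calc _ = ‖u‖ * ‖v‖ * (‖dualFamily V a‖ * ‖V a‖) := by ring
    _ ≤ _ := mul_le_mul_of_nonneg_left h2 (by positivity)

/-- The expectation is an invariant bilinear form in `u` and `v`, hence determined by its trace, and
the trace is the expectation of `⟪V a, v a⟫ = 1`. -/
lemma integral_inner_mul_inner_dualFamily (a : ι) (u v : F) :
    ∫ V, ⟪V a, u⟫ * ⟪dualFamily V a, v⟫ ∂(gaussianFamily ι F) = ⟪u, v⟫ / finrank ℝ F := by
  have hi := integrable_inner_mul_inner_dualFamily h a
  let A : LinearMap.BilinForm ℝ F := LinearMap.mk₂ ℝ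
    (fun u v => ∫ V, ⟪V a, u⟫ * ⟪dualFamily V a, v⟫ ∂(gaussianFamily ι F))
    (fun u u' v => by
      rw [← integral_add (hi u v) (hi u' v)]; simp only [inner_add_right, add_mul])
    (fun c u v => by
      rw [smul_eq_mul, ← integral_const_mul]; simp only [inner_smul_right, mul_assoc])
    (fun u v v' => by
      rw [← integral_add (hi u v) (hi u v')]; simp only [inner_add_right, mul_add])
    (fun c u v => by
      rw [smul_eq_mul, ← integral_const_mul]; simp only [inner_smul_right, mul_left_comm])
  have hA : ∀ u v, A u v = ∫ V, ⟪V a, u⟫ * ⟪dualFamily V a, v⟫ ∂(gaussianFamily ι F) :=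
    fun _ _ => rfl
  rw [← hA, bilin_eq_of_isometry_invariant A fun U u v => ?_]
  · simp_rw [hA]
    rw [← integral_finsetSum _ fun i _ => hi _ _]
    have h1 : ∀ᵐ V ∂(gaussianFamily ι F), ∑ i, ⟪V a, stdOrthonormalBasis ℝ F i⟫
        * ⟪dualFamily V a, stdOrthonormalBasis ℝ F i⟫ = 1 := by
      filter_upwards [ae_linearIndependent_gaussianFamily (ι := ι) (F := F) (by omega)] with V hV
      simp_rw [real_inner_comm _ (dualFamily V a)]
      rw [OrthonormalBasis.sum_inner_mul_inner, real_inner_comm, inner_dualFamily hV, if_pos rfl]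
    rw [integral_congr_ae h1]
    simp [div_eq_mul_inv, mul_comm]
  · have hm := measurePreserving_linearIsometryEquiv (ι := ι) U
    rw [hA, hA]
    nth_rewrite 1 [← hm.map_eq]
    rw [integral_map hm.aemeasurable (Measurable.aestronglyMeasurable (by fun_prop))]
    simp [dualFamily_comp_linearIsometryEquiv]

/-- `E[⟪v_a, v_b⟫ ⟪x_a, x_b⟫]` for a Gaussian family `x` with biorthogonal family `v`. -/
lemma integral_inner_dualFamily_mul_inner_self (a b : ι) :
    ∫ V, ⟪dualFamily V a, dualFamily V b⟫ * ⟪V a, V b⟫ ∂(gaussianFamily ι F)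
      = (if a = b then (finrank ℝ F : ℝ) - 2 else -1)
        / ((finrank ℝ F : ℝ) - Fintype.card ι - 1) := by
  have hi : ∀ b, Integrable (fun V => ⟪dualFamily V a, dualFamily V b⟫ * ⟪V a, V b⟫)
      (gaussianFamily ι F) := by
    intro b
    have h1 := integrable_finsetSum Finset.univ fun i _ =>
      integrable_inner_dualFamily_mul_inner_mul_inner h a b (stdOrthonormalBasis ℝ F i)
        (stdOrthonormalBasis ℝ F i)
    refine h1.congr (ae_of_all _ fun V => ?_)
    simp only
    rw [← Finset.mul_sum]
    simp_rw [real_inner_comm _ (V b)]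
    rw [OrthonormalBasis.sum_inner_mul_inner]
  have hdiag : ∫ V, ⟪dualFamily V a, dualFamily V a⟫ * ⟪V a, V a⟫ ∂(gaussianFamily ι F)
      = ((finrank ℝ F : ℝ) - 2) / ((finrank ℝ F : ℝ) - Fintype.card ι - 1) := by
    simp_rw [real_inner_self_eq_norm_sq]
    exact (integral_norm_sq_dualFamily_mul_norm_sq h a).2
  rcases eq_or_ne a b with rfl | hab
  · rw [if_pos rfl, hdiag]
  rw [if_neg hab]
  set τ := ∫ V, ⟪dualFamily V a, dualFamily V b⟫ * ⟪V a, V b⟫ ∂(gaussianFamily ι F)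
  -- Exchangeability: the transposition of `b` and `c` fixes `a` and preserves the law of the
  -- family.
  have hoff : ∀ c ∈ Finset.univ.erase a,
      ∫ V, ⟪dualFamily V a, dualFamily V c⟫ * ⟪V a, V c⟫ ∂(gaussianFamily ι F) = τ := by
    intro c hc
    have hm := measurePreserving_perm (F := F) (Equiv.swap b c)
    rw [← hm.map_eq]
    rw [integral_map hm.aemeasurable (Measurable.aestronglyMeasurable (by fun_prop))]
    simp only [dualFamily_comp_perm, Function.comp_apply, Equiv.swap_apply_right,
      Equiv.swap_apply_of_ne_of_ne hab (Finset.ne_of_mem_erase hc).symm]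
    rfl
  -- Biorthogonality gives one linear equation: the diagonal value plus `card ι - 1` equal
  -- off-diagonal values is `1`.
  have hsum : ∑ c, ∫ V, ⟪dualFamily V a, dualFamily V c⟫ * ⟪V a, V c⟫ ∂(gaussianFamily ι F)
      = 1 := by
    rw [← integral_finsetSum _ fun c _ => hi c]
    have h1 : ∀ᵐ V ∂(gaussianFamily ι F),
        ∑ c, ⟪dualFamily V a, dualFamily V c⟫ * ⟪V a, V c⟫ = 1 := by
      filter_upwards [ae_linearIndependent_gaussianFamily (ι := ι) (F := F) (by omega)] with V hV
      simp_rw [real_inner_comm _ (V a)]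
      rw [sum_inner_dualFamily_mul_inner hV, inner_dualFamily hV, if_pos rfl]
    rw [integral_congr_ae h1]
    simp
  rw [← Finset.add_sum_erase _ _ (Finset.mem_univ a), Finset.sum_congr rfl hoff, hdiag,
    Finset.sum_const, Finset.card_erase_of_mem (Finset.mem_univ a), Finset.card_univ,
    nsmul_eq_mul, Nat.cast_sub (Fintype.card_pos_iff.2 ⟨a⟩), Nat.cast_one] at hsum
  have hpos := finrank_sub_card_sub_one_pos h
  have hcard : (1 : ℝ) < Fintype.card ι := by
    exact_mod_cast Fintype.one_lt_card_iff.2 ⟨a, b, hab⟩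
  rw [eq_div_iff hpos.ne']
  rw [div_add' _ _ _ hpos.ne', div_eq_one_iff_eq hpos.ne'] at hsum
  -- The first factor is nonzero because `a ≠ b`, so the second one vanishes and determines `τ`.
  have h2 : ((Fintype.card ι : ℝ) - 1) * (τ * ((finrank ℝ F : ℝ) - Fintype.card ι - 1) + 1) = 0 := by
    linarith
  rcases mul_eq_zero.1 h2 with h3 | h3 <;> linarith

/-- Again an invariant bilinear form. Its trace is the moment computed in
`integral_inner_dualFamily_mul_inner_self`. -/
lemma integral_inner_dualFamily_mul_inner_mul_inner (a b : ι) (u v : F) :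
    ∫ V, ⟪dualFamily V a, dualFamily V b⟫ * (⟪V a, u⟫ * ⟪V b, v⟫) ∂(gaussianFamily ι F)
      = (if a = b then (finrank ℝ F : ℝ) - 2 else -1)
        / ((finrank ℝ F : ℝ) - Fintype.card ι - 1) / finrank ℝ F * ⟪u, v⟫ := by
  have hi := integrable_inner_dualFamily_mul_inner_mul_inner h a b
  let A : LinearMap.BilinForm ℝ F := LinearMap.mk₂ ℝ
    (fun u v => ∫ V, ⟪dualFamily V a, dualFamily V b⟫ * (⟪V a, u⟫ * ⟪V b, v⟫)
      ∂(gaussianFamily ι F))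
    (fun u u' v => by
      rw [← integral_add (hi u v) (hi u' v)]; simp only [inner_add_right, add_mul, mul_add])
    (fun c u v => by
      rw [smul_eq_mul, ← integral_const_mul]
      simp only [inner_smul_right, mul_assoc, mul_left_comm c])
    (fun u v v' => by
      rw [← integral_add (hi u v) (hi u v')]; simp only [inner_add_right, mul_add])
    (fun c u v => by
      rw [smul_eq_mul, ← integral_const_mul]
      simp only [inner_smul_right, mul_left_comm c])
  have hA : ∀ u v, A u v = ∫ V, ⟪dualFamily V a, dualFamily V b⟫ * (⟪V a, u⟫ * ⟪V b, v⟫)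
      ∂(gaussianFamily ι F) := fun _ _ => rfl
  rw [← hA, bilin_eq_of_isometry_invariant A fun U u v => ?_]
  · simp_rw [hA]
    rw [← integral_finsetSum _ fun i _ => hi _ _, ← integral_inner_dualFamily_mul_inner_self h]
    congr 3
    ext V
    rw [← Finset.mul_sum]
    simp_rw [real_inner_comm _ (V b)]
    rw [OrthonormalBasis.sum_inner_mul_inner]
  · have hm := measurePreserving_linearIsometryEquiv (ι := ι) U
    rw [hA, hA]
    nth_rewrite 1 [← hm.map_eq]
    rw [integral_map hm.aemeasurable (Measurable.aestronglyMeasurable (by fun_prop))]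
    simp [dualFamily_comp_linearIsometryEquiv]

end GaussianFamilyMoments

/-! ### Expected squared error after one update. -/

section ErrorAfterUpdate

open Module
open scoped RealInnerProductSpace ENNReal

universe u v

variable {ι : Type u} {F : Type v} [Fintype ι] [DecidableEq ι] [NormedAddCommGroup F]
  [InnerProductSpace ℝ F]

/-- The point closest to `w` among the solutions of `⟪V a, ·⟫ = y a`, if `V` is linearly
independent. -/
noncomputable def fitUpdate (V : ι → F) (y : ι → ℝ) (w : F) : F :=
  w + ∑ a, (y a - ⟪V a, w⟫) • dualFamily V a

variable [FiniteDimensional ℝ F] [MeasurableSpace F] [BorelSpace F]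
  {Ω : Type*} [MeasurableSpace Ω] {P : Measure Ω} [IsProbabilityMeasure P]

omit [IsProbabilityMeasure P] in
lemma integrable_comp_of_hasLaw {α : Type*} [MeasurableSpace α] {μ : Measure α} {X : Ω → α}
    (hX : HasLaw X μ P) {f : α → ℝ} (hf : Integrable f μ) : Integrable (fun ω => f (X ω)) P := by
  rw [← hX.map_eq] at hf
  exact hf.comp_aemeasurable hX.aemeasurable

variable {V : Ω → ι → F} (hV : HasLaw V (gaussianFamily ι F) P)
  (h : Fintype.card ι + 1 < finrank ℝ F)

include hV h

-- The sum over `a` is almost surely the squared projection of `d` onto the span of `V`. Expanding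
-- in an orthonormal basis turns each summand into a finite sum of products to which independence of
-- `d` and `V` applies.
omit [IsProbabilityMeasure P] in
lemma integral_sum_inner_mul_inner_dualFamily {d : Ω → F} (hd : AEStronglyMeasurable d P)
    (hd2 : Integrable (fun ω => ‖d ω‖ ^ 2) P) (hdV : IndepFun d V P) :
    Integrable (fun ω => ∑ a, ⟪V ω a, d ω⟫ * ⟪dualFamily (V ω) a, d ω⟫) P ∧
      ∫ ω, ∑ a, ⟪V ω a, d ω⟫ * ⟪dualFamily (V ω) a, d ω⟫ ∂P
        = Fintype.card ι / finrank ℝ F * ∫ ω, ‖d ω‖ ^ 2 ∂P := by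
  set b := stdOrthonormalBasis ℝ F
  have hexp : ∀ ω a, ⟪V ω a, d ω⟫ * ⟪dualFamily (V ω) a, d ω⟫
      = ∑ i, ∑ j, (⟪b i, d ω⟫ * ⟪b j, d ω⟫) * (⟪V ω a, b i⟫ * ⟪dualFamily (V ω) a, b j⟫) := by
    intro ω a
    rw [← b.sum_inner_mul_inner (V ω a), ← b.sum_inner_mul_inner (dualFamily (V ω) a),
      Finset.sum_mul_sum]
    exact Finset.sum_congr rfl fun i _ => Finset.sum_congr rfl fun j _ => by ring
  have hdd : ∀ i j, Integrable (fun ω => ⟪b i, d ω⟫ * ⟪b j, d ω⟫) P := by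
    intro i j
    refine hd2.mono' (by fun_prop) (ae_of_all _ fun ω => ?_)
    rw [norm_mul, sq]
    refine mul_le_mul ?_ ?_ (norm_nonneg _) (norm_nonneg _)
    · simpa using norm_inner_le_norm (𝕜 := ℝ) (b i) (d ω)
    · simpa using norm_inner_le_norm (𝕜 := ℝ) (b j) (d ω)
  have hindep : ∀ a i j, IndepFun (fun ω => ⟪b i, d ω⟫ * ⟪b j, d ω⟫)
      (fun ω => ⟪V ω a, b i⟫ * ⟪dualFamily (V ω) a, b j⟫) P := by
    intro a i j
    exact hdV.comp (φ := fun x => ⟪b i, x⟫ * ⟪b j, x⟫)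
      (ψ := fun W => ⟪W a, b i⟫ * ⟪dualFamily W a, b j⟫) (by fun_prop) (by fun_prop)
  have hVi : ∀ a i j, Integrable (fun ω => ⟪V ω a, b i⟫ * ⟪dualFamily (V ω) a, b j⟫) P :=
    fun a i j => integrable_comp_of_hasLaw hV (integrable_inner_mul_inner_dualFamily h a (b i) (b j))
  have hint : ∀ a i j, Integrable (fun ω => (⟪b i, d ω⟫ * ⟪b j, d ω⟫)
      * (⟪V ω a, b i⟫ * ⟪dualFamily (V ω) a, b j⟫)) P :=
    fun a i j => (hindep a i j).integrable_mul (hdd i j) (hVi a i j)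
  have hval : ∀ a i j, ∫ ω, (⟪b i, d ω⟫ * ⟪b j, d ω⟫)
      * (⟪V ω a, b i⟫ * ⟪dualFamily (V ω) a, b j⟫) ∂P
      = if i = j then (∫ ω, ⟪b i, d ω⟫ ^ 2 ∂P) / finrank ℝ F else 0 := by
    intro a i j
    rw [(hindep a i j).integral_fun_mul_eq_mul_integral (hdd i j).aestronglyMeasurable
      (hVi a i j).aestronglyMeasurable]
    have h1 : ∫ ω, ⟪V ω a, b i⟫ * ⟪dualFamily (V ω) a, b j⟫ ∂P = ⟪b i, b j⟫ / finrank ℝ F := by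
      rw [← integral_inner_mul_inner_dualFamily h a]
      exact hV.integral_comp (f := fun W => ⟪W a, b i⟫ * ⟪dualFamily W a, b j⟫)
        (Measurable.aestronglyMeasurable (by fun_prop))
    rw [h1, orthonormal_iff_ite.1 b.orthonormal]
    split_ifs with hij
    · subst hij
      simp [sq, div_eq_mul_inv]
    · simp
  simp_rw [hexp]
  refine ⟨integrable_finsetSum _ fun a _ => integrable_finsetSum _ fun i _ =>
    integrable_finsetSum _ fun j _ => hint a i j, ?_⟩
  rw [integral_finsetSum _ fun a _ => integrable_finsetSum _ fun i _ =>
    integrable_finsetSum _ fun j _ => hint a i j]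
  have h2 : ∀ a ∈ Finset.univ, ∫ ω, ∑ i, ∑ j, (⟪b i, d ω⟫ * ⟪b j, d ω⟫)
      * (⟪V ω a, b i⟫ * ⟪dualFamily (V ω) a, b j⟫) ∂P
      = (∫ ω, ‖d ω‖ ^ 2 ∂P) / finrank ℝ F := by
    intro a _
    rw [integral_finsetSum _ fun i _ => integrable_finsetSum _ fun j _ => hint a i j]
    have h3 : ∀ i ∈ Finset.univ, ∫ ω, ∑ j, (⟪b i, d ω⟫ * ⟪b j, d ω⟫)
        * (⟪V ω a, b i⟫ * ⟪dualFamily (V ω) a, b j⟫) ∂P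
        = (∫ ω, ⟪b i, d ω⟫ ^ 2 ∂P) / finrank ℝ F := by
      intro i _
      rw [integral_finsetSum _ fun j _ => hint a i j]
      simp [hval]
    rw [Finset.sum_congr rfl h3, ← Finset.sum_div, ← integral_finsetSum]
    · simp_rw [b.sum_sq_inner_right]
    · exact fun i _ => (hdd i i).congr (ae_of_all _ fun ω => (sq _).symm)
  rw [Finset.sum_congr rfl h2, Finset.sum_const, Finset.card_univ, nsmul_eq_mul]
  ring

/-- Expanding the residuals, the terms linear in the noise vanish because it is centred and
independent of `V`, and the quadratic noise terms survive only on the diagonal. -/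
lemma integral_sum_residual_mul_residual {z : Ω → ι → ℝ} {s : ℝ} (hVz : IndepFun V z P)
    (hz : ∀ a, MemLp (fun ω => z ω a) 2 P) (hz1 : ∀ a, ∫ ω, z ω a ∂P = 0)
    (hz2 : ∀ a b, ∫ ω, z ω a * z ω b ∂P = if a = b then s else 0) (k : ι → F) :
    Integrable (fun ω => ∑ a, ∑ b, (⟪V ω a, k a⟫ + z ω a) * (⟪V ω b, k b⟫ + z ω b)
      * ⟪dualFamily (V ω) a, dualFamily (V ω) b⟫) P ∧
    ∫ ω, ∑ a, ∑ b, (⟪V ω a, k a⟫ + z ω a) * (⟪V ω b, k b⟫ + z ω b)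
      * ⟪dualFamily (V ω) a, dualFamily (V ω) b⟫ ∂P
      = 1 / (finrank ℝ F * ((finrank ℝ F : ℝ) - Fintype.card ι - 1))
          * (∑ a, ∑ b, (if a = b then (finrank ℝ F : ℝ) - 2 else -1) * ⟪k a, k b⟫)
        + Fintype.card ι * s / ((finrank ℝ F : ℝ) - Fintype.card ι - 1) := by
  have hexp : ∀ ω a b, (⟪V ω a, k a⟫ + z ω a) * (⟪V ω b, k b⟫ + z ω b)
        * ⟪dualFamily (V ω) a, dualFamily (V ω) b⟫
      = ⟪dualFamily (V ω) a, dualFamily (V ω) b⟫ * (⟪V ω a, k a⟫ * ⟪V ω b, k b⟫)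
        + (⟪dualFamily (V ω) a, dualFamily (V ω) b⟫ * ⟪V ω a, k a⟫) * z ω b
        + (⟪dualFamily (V ω) b, dualFamily (V ω) a⟫ * ⟪V ω b, k b⟫) * z ω a
        + ⟪dualFamily (V ω) a, dualFamily (V ω) b⟫ * (z ω a * z ω b) := by
    intro ω a b
    rw [real_inner_comm (dualFamily (V ω) a) (dualFamily (V ω) b)]
    ring
  have hi1 := fun a b => integrable_comp_of_hasLaw hV
    (integrable_inner_dualFamily_mul_inner_mul_inner h a b (k a) (k b))
  have hI2 := fun a b => integrable_comp_of_hasLaw hV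
    (integrable_inner_dualFamily_mul_inner h a b (k a))
  have hI4 := fun a b => integrable_comp_of_hasLaw hV (integrable_inner_dualFamily h a b)
  have hz' : ∀ a, Integrable (fun ω => z ω a) P := fun a => (hz a).integrable one_le_two
  have hzz : ∀ a b, Integrable (fun ω => z ω a * z ω b) P := fun a b =>
    (hz a).integrable_mul (hz b)
  have hind2 : ∀ a b, IndepFun
      (fun ω => ⟪dualFamily (V ω) a, dualFamily (V ω) b⟫ * ⟪V ω a, k a⟫) (fun ω => z ω b) P :=
    fun a b => hVz.comp (φ := fun W => ⟪dualFamily W a, dualFamily W b⟫ * ⟪W a, k a⟫)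
      (ψ := fun x : ι → ℝ => x b) (by fun_prop) (by fun_prop)
  have hind4 : ∀ a b, IndepFun
      (fun ω => ⟪dualFamily (V ω) a, dualFamily (V ω) b⟫) (fun ω => z ω a * z ω b) P :=
    fun a b => hVz.comp (φ := fun W => ⟪dualFamily W a, dualFamily W b⟫)
      (ψ := fun x : ι → ℝ => x a * x b) (by fun_prop) (by fun_prop)
  have hi2 : ∀ a b, Integrable
      (fun ω => (⟪dualFamily (V ω) a, dualFamily (V ω) b⟫ * ⟪V ω a, k a⟫) * z ω b) P :=
    fun a b => (hind2 a b).integrable_mul (hI2 a b) (hz' b)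
  have hi4 : ∀ a b, Integrable
      (fun ω => ⟪dualFamily (V ω) a, dualFamily (V ω) b⟫ * (z ω a * z ω b)) P :=
    fun a b => (hind4 a b).integrable_mul (hI4 a b) (hzz a b)
  have hv1 : ∀ a b, ∫ ω, ⟪dualFamily (V ω) a, dualFamily (V ω) b⟫
      * (⟪V ω a, k a⟫ * ⟪V ω b, k b⟫) ∂P
      = (if a = b then (finrank ℝ F : ℝ) - 2 else -1)
        / ((finrank ℝ F : ℝ) - Fintype.card ι - 1) / finrank ℝ F * ⟪k a, k b⟫ := by
    intro a b
    rw [← integral_inner_dualFamily_mul_inner_mul_inner h]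
    exact hV.integral_comp
      (f := fun W => ⟪dualFamily W a, dualFamily W b⟫ * (⟪W a, k a⟫ * ⟪W b, k b⟫))
      (Measurable.aestronglyMeasurable (by fun_prop))
  have hv2 : ∀ a b, ∫ ω, (⟪dualFamily (V ω) a, dualFamily (V ω) b⟫ * ⟪V ω a, k a⟫) * z ω b ∂P
      = 0 := by
    intro a b
    rw [(hind2 a b).integral_fun_mul_eq_mul_integral (hI2 a b).aestronglyMeasurable
      (hz' b).aestronglyMeasurable, hz1, mul_zero]
  have hv4 : ∀ a b, ∫ ω, ⟪dualFamily (V ω) a, dualFamily (V ω) b⟫ * (z ω a * z ω b) ∂P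
      = if a = b then s / ((finrank ℝ F : ℝ) - Fintype.card ι - 1) else 0 := by
    intro a b
    rw [(hind4 a b).integral_fun_mul_eq_mul_integral (hI4 a b).aestronglyMeasurable
      (hzz a b).aestronglyMeasurable, hz2]
    split_ifs with hab
    · subst hab
      have h1 : ∫ ω, ⟪dualFamily (V ω) a, dualFamily (V ω) a⟫ ∂P
          = 1 / ((finrank ℝ F : ℝ) - Fintype.card ι - 1) := by
        rw [← (integral_norm_sq_dualFamily h a).2]
        simp_rw [real_inner_self_eq_norm_sq]
        exact hV.integral_comp (f := fun W => ‖dualFamily W a‖ ^ 2)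
          (Measurable.aestronglyMeasurable (by fun_prop))
      rw [h1, one_div_mul_eq_div]
    · rw [mul_zero]
  have hint : ∀ a b, Integrable (fun ω => (⟪V ω a, k a⟫ + z ω a) * (⟪V ω b, k b⟫ + z ω b)
        * ⟪dualFamily (V ω) a, dualFamily (V ω) b⟫) P := by
    intro a b
    simp_rw [hexp]
    exact (((hi1 a b).add (hi2 a b)).add (hi2 b a)).add (hi4 a b)
  refine ⟨integrable_finsetSum _ fun a _ => integrable_finsetSum _ fun b _ => hint a b, ?_⟩
  rw [integral_finsetSum _ fun a _ => integrable_finsetSum _ fun b _ => hint a b]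
  have h1 : ∀ a ∈ Finset.univ, ∫ ω, ∑ b, (⟪V ω a, k a⟫ + z ω a) * (⟪V ω b, k b⟫ + z ω b)
        * ⟪dualFamily (V ω) a, dualFamily (V ω) b⟫ ∂P
      = 1 / (finrank ℝ F * ((finrank ℝ F : ℝ) - Fintype.card ι - 1))
          * (∑ b, (if a = b then (finrank ℝ F : ℝ) - 2 else -1) * ⟪k a, k b⟫)
        + s / ((finrank ℝ F : ℝ) - Fintype.card ι - 1) := by
    intro a _
    rw [integral_finsetSum _ fun b _ => hint a b]
    have h2 : ∀ b ∈ Finset.univ, ∫ ω, (⟪V ω a, k a⟫ + z ω a) * (⟪V ω b, k b⟫ + z ω b)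
        * ⟪dualFamily (V ω) a, dualFamily (V ω) b⟫ ∂P
        = 1 / (finrank ℝ F * ((finrank ℝ F : ℝ) - Fintype.card ι - 1))
          * ((if a = b then (finrank ℝ F : ℝ) - 2 else -1) * ⟪k a, k b⟫)
          + if a = b then s / ((finrank ℝ F : ℝ) - Fintype.card ι - 1) else 0 := by
      intro b _
      simp_rw [hexp]
      rw [integral_add (((hi1 a b).fun_add (hi2 a b)).fun_add (hi2 b a)) (hi4 a b),
        integral_add ((hi1 a b).fun_add (hi2 a b)) (hi2 b a), integral_add (hi1 a b) (hi2 a b),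
        hv1, hv2, hv2, hv4, add_zero, add_zero]
      congr 1
      simp only [div_eq_mul_inv, mul_inv]
      ring
    rw [Finset.sum_congr rfl h2, Finset.sum_add_distrib, ← Finset.mul_sum]
    simp
  rw [Finset.sum_congr rfl h1, Finset.sum_add_distrib, ← Finset.mul_sum]
  simp only [Finset.sum_const, Finset.card_univ, nsmul_eq_mul]
  ring

/-- Independence of `w` and `z` is not needed: the retained part of the old error is orthogonal to
the span of `V`, so its product with the noise vanishes pointwise. Pairwise distances replace inner
products in order that the reference point `x` enters only through `‖u a - x‖²` and the old error.
-/
lemma integral_norm_sq_fitUpdate_sub {z : Ω → ι → ℝ} {s : ℝ} (hVz : IndepFun V z P)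
    (hz : ∀ a, MemLp (fun ω => z ω a) 2 P) (hz1 : ∀ a, ∫ ω, z ω a ∂P = 0)
    (hz2 : ∀ a b, ∫ ω, z ω a * z ω b ∂P = if a = b then s else 0)
    {w : Ω → F} (hw : AEStronglyMeasurable w P) (hwV : IndepFun w V P) (u : ι → F) (x : F)
    (hw2 : Integrable (fun ω => ‖w ω - x‖ ^ 2) P) :
    Integrable (fun ω => ‖fitUpdate (V ω) (fun a => ⟪V ω a, u a⟫ + z ω a) (w ω) - x‖ ^ 2) P ∧
    ∫ ω, ‖fitUpdate (V ω) (fun a => ⟪V ω a, u a⟫ + z ω a) (w ω) - x‖ ^ 2 ∂P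
      = (1 - Fintype.card ι / finrank ℝ F) * ∫ ω, ‖w ω - x‖ ^ 2 ∂P
        + 1 / finrank ℝ F * ∑ a, ‖u a - x‖ ^ 2
        + 1 / (2 * finrank ℝ F * ((finrank ℝ F : ℝ) - Fintype.card ι - 1))
          * ∑ a, ∑ b, ‖u a - u b‖ ^ 2
        + Fintype.card ι * s / ((finrank ℝ F : ℝ) - Fintype.card ι - 1) := by
  obtain ⟨hi1, hv1⟩ := integral_sum_inner_mul_inner_dualFamily hV h (d := fun ω => w ω - x)
    (hw.sub aestronglyMeasurable_const) hw2
    (hwV.comp (φ := fun y => y - x) (ψ := id) (by fun_prop) measurable_id)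
  obtain ⟨hi2, hv2⟩ := integral_sum_residual_mul_residual hV h hVz hz hz1 hz2 (fun a => u a - x)
  have hli : ∀ᵐ ω ∂P, LinearIndependent ℝ (V ω) := by
    have h1 := ae_linearIndependent_gaussianFamily (ι := ι) (F := F) (by omega)
    rw [← hV.map_eq] at h1
    exact ae_of_ae_map hV.aemeasurable h1
  have hexp : ∀ᵐ ω ∂P, ‖fitUpdate (V ω) (fun a => ⟪V ω a, u a⟫ + z ω a) (w ω) - x‖ ^ 2
      = (‖w ω - x‖ ^ 2 - ∑ a, ⟪V ω a, w ω - x⟫ * ⟪dualFamily (V ω) a, w ω - x⟫)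
        + ∑ a, ∑ b, (⟪V ω a, u a - x⟫ + z ω a) * (⟪V ω b, u b - x⟫ + z ω b)
          * ⟪dualFamily (V ω) a, dualFamily (V ω) b⟫ := by
    filter_upwards [hli] with ω hω
    rw [← norm_sq_add_sum_dualFamily hω, fitUpdate, add_sub_right_comm]
    congr 4
    ext a
    congr 1
    rw [inner_sub_right, inner_sub_right]
    ring
  refine ⟨((hw2.sub hi1).add hi2).congr (hexp.mono fun _ hω => hω.symm), ?_⟩
  rw [integral_congr_ae hexp, integral_add (hw2.sub' hi1) hi2, integral_sub hw2 hi1, hv1, hv2]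
  have hp : (0 : ℝ) < finrank ℝ F := by
    have : 0 < finrank ℝ F := by omega
    exact_mod_cast this
  have hg := finrank_sub_card_sub_one_pos h
  -- Polarization, with the diagonal weight `p - 2` read as `(p - 1) - 1`, where `p` is the
  -- dimension. The two subtracted norm sums reduce `p - 1` by `card ι`, which produces the factor
  -- that cancels the denominator.
  have hpol : ∑ a, ∑ b, (if a = b then (finrank ℝ F : ℝ) - 2 else -1) * ⟪u a - x, u b - x⟫
      = ((finrank ℝ F : ℝ) - Fintype.card ι - 1) * ∑ a, ‖u a - x‖ ^ 2
        + 1 / 2 * ∑ a, ∑ b, ‖u a - u b‖ ^ 2 := by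
    have h1 : ∀ a b, (if a = b then (finrank ℝ F : ℝ) - 2 else -1) * ⟪u a - x, u b - x⟫
        = (if a = b then ((finrank ℝ F : ℝ) - 1) * ‖u a - x‖ ^ 2 else 0)
          + 1 / 2 * ‖u a - u b‖ ^ 2 - 1 / 2 * ‖u a - x‖ ^ 2 - 1 / 2 * ‖u b - x‖ ^ 2 := by
      intro a b
      have h2 := norm_sub_sq_real (u a - x) (u b - x)
      rw [sub_sub_sub_cancel_right] at h2
      split_ifs with hab
      · subst hab
        rw [real_inner_self_eq_norm_sq, sub_self, norm_zero]
        ring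
      · rw [h2]
        ring
    simp_rw [h1]
    simp only [Finset.sum_sub_distrib, Finset.sum_add_distrib, Finset.sum_ite_eq, Finset.mem_univ,
      if_true, Finset.sum_const, Finset.card_univ, nsmul_eq_mul, ← Finset.mul_sum]
    ring
  rw [hpol]
  field_simp
  ring

end ErrorAfterUpdate

/-! ### The closest point as an explicit update. -/

section ClosestPoint

open scoped RealInnerProductSpace

lemma inner_fitUpdate {ι F : Type*} [Fintype ι] [DecidableEq ι] [NormedAddCommGroup F]
    [InnerProductSpace ℝ F] {V : ι → F} (hV : LinearIndependent ℝ V) (y : ι → ℝ) (w : F) (a : ι) :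
    ⟪V a, fitUpdate V y w⟫ = y a := by
  rw [real_inner_comm, fitUpdate, inner_add_left, sum_inner]
  simp [inner_smul_left, inner_dualFamily hV, real_inner_comm w]

/-- The displacement of `fitUpdate` lies in the span of `V`, while differences of solutions are
orthogonal to it. Pythagoras gives both existence and uniqueness of the minimizer, and uniqueness
identifies the point picked by `Classical.epsilon`. -/
lemma closestPoint_eq_fitUpdate {p : ℕ} {ι : Type*} [Fintype ι] [DecidableEq ι]
    {V : ι → EuclideanSpace ℝ (Fin p)} (hV : LinearIndependent ℝ V) (y : ι → ℝ)
    (w : EuclideanSpace ℝ (Fin p)) :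
    closestPoint {v | ∀ a, ⟪V a, v⟫ = y a} w = fitUpdate V y w := by
  set w₁ := fitUpdate V y w
  have hpyth : ∀ v ∈ {v | ∀ a, ⟪V a, v⟫ = y a}, ‖v - w‖ ^ 2 = ‖v - w₁‖ ^ 2 + ‖w₁ - w‖ ^ 2 := by
    intro v hv
    have horth : ∀ x ∈ Submodule.span ℝ (Set.range V), ⟪v - w₁, x⟫ = 0 := by
      intro x hx
      induction hx using Submodule.span_induction with
      | mem x hx =>
        obtain ⟨a, rfl⟩ := hx
        rw [inner_sub_left, real_inner_comm, real_inner_comm (V a) w₁, hv a, inner_fitUpdate hV,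
          sub_self]
      | zero => simp
      | add x y _ _ hx hy => rw [inner_add_right, hx, hy, add_zero]
      | smul c x _ hx => rw [inner_smul_right, hx, mul_zero]
    have hmem : w₁ - w ∈ Submodule.span ℝ (Set.range V) := by
      rw [show w₁ - w = ∑ a, (y a - ⟪V a, w⟫) • dualFamily V a by simp [w₁, fitUpdate]]
      exact Submodule.sum_mem _ fun a _ => Submodule.smul_mem _ _ (dualFamily_mem_span V a)
    rw [← sub_add_sub_cancel v w₁ w, norm_add_sq_real, horth _ hmem]
    ring
  have hex : ∃ v, v ∈ {v | ∀ a, ⟪V a, v⟫ = y a} ∧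
      IsMinOn (fun v => ‖v - w‖ ^ 2) {v | ∀ a, ⟪V a, v⟫ = y a} v := by
    refine ⟨w₁, fun a => inner_fitUpdate hV y w a, fun v hv => ?_⟩
    change ‖w₁ - w‖ ^ 2 ≤ ‖v - w‖ ^ 2
    rw [hpyth v hv]
    exact le_add_of_nonneg_left (sq_nonneg _)
  obtain ⟨h1, h2⟩ := Classical.epsilon_spec hex
  have h3 : ‖_ - w‖ ^ 2 ≤ ‖w₁ - w‖ ^ 2 := h2 (fun a => inner_fitUpdate hV y w a)
  rw [hpyth _ h1] at h3
  have h4 : ‖closestPoint {v | ∀ a, ⟪V a, v⟫ = y a} w - w₁‖ ^ 2 ≤ 0 := by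
    rw [closestPoint]
    linarith
  exact sub_eq_zero.1 (norm_eq_zero.1 (pow_eq_zero_iff two_ne_zero |>.1
    (le_antisymm h4 (sq_nonneg _))))

end ClosestPoint

/-! ### Dependence on subsets of the scalar data. -/

section AEFunctionOf

variable {Ω κ β γ : Type*} [MeasurableSpace Ω] [MeasurableSpace β] [MeasurableSpace γ]

/-- `w` is almost surely a measurable function of the random variables `f c`, `c ∈ A`. -/
def AEFunctionOf (P : Measure Ω) (f : κ → Ω → ℝ) (A : Set κ) (w : Ω → β) : Prop :=
  ∃ g : (A → ℝ) → β, Measurable g ∧ w =ᵐ[P] fun ω => g fun c => f c ω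

variable {P : Measure Ω} {f : κ → Ω → ℝ} {A B : Set κ} {w : Ω → β} {v : Ω → γ}

lemma AEFunctionOf.mono (h : AEFunctionOf P f A w) (hAB : A ⊆ B) : AEFunctionOf P f B w := by
  obtain ⟨g, hg, hw⟩ := h
  exact ⟨fun x => g fun c => x ⟨c, hAB c.2⟩, by fun_prop, hw⟩

lemma AEFunctionOf.const (x : β) : AEFunctionOf P f A fun _ => x :=
  ⟨fun _ => x, measurable_const, ae_of_all _ fun _ => rfl⟩

/-- The almost-sure formulation matters here: `closestPoint` is identified with the measurable
`fitUpdate` only where the samples are linearly independent. -/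
lemma AEFunctionOf.congr {w' : Ω → β} (h : AEFunctionOf P f A w) (hw : w' =ᵐ[P] w) :
    AEFunctionOf P f A w' := by
  obtain ⟨g, hg, hg'⟩ := h
  exact ⟨g, hg, hw.trans hg'⟩

lemma AEFunctionOf.prodMk (hw : AEFunctionOf P f A w) (hv : AEFunctionOf P f A v) :
    AEFunctionOf P f A fun ω => (w ω, v ω) := by
  obtain ⟨g, hg, hg'⟩ := hw
  obtain ⟨k, hk, hk'⟩ := hv
  exact ⟨fun x => (g x, k x), by fun_prop, hg'.prodMk hk'⟩

lemma AEFunctionOf.comp (hw : AEFunctionOf P f A w) {φ : β → γ} (hφ : Measurable φ) :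
    AEFunctionOf P f A fun ω => φ (w ω) := by
  obtain ⟨g, hg, hg'⟩ := hw
  exact ⟨fun x => φ (g x), by fun_prop, hg'.fun_comp φ⟩

lemma AEFunctionOf.aemeasurable (hw : AEFunctionOf P f A w) (hf : ∀ c, AEMeasurable (f c) P)
    [Countable κ] : AEMeasurable w P := by
  obtain ⟨g, hg, hg'⟩ := hw
  exact AEMeasurable.congr
    (hg.comp_aemeasurable (aemeasurable_pi_lambda _ fun c => hf c)) hg'.symm

lemma AEFunctionOf.indepFun [Finite κ] (hw : AEFunctionOf P f A w) (hv : AEFunctionOf P f B v)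
    (hAB : Disjoint A B) (hf : ∀ c, AEMeasurable (f c) P) (hind : iIndepFun f P) :
    IndepFun w v P := by
  obtain ⟨g, hg, hg'⟩ := hw
  obtain ⟨k, hk, hk'⟩ := hv
  have hA := A.toFinite
  have hB := B.toFinite
  have h1 := hind.indepFun_finset₀ hA.toFinset hB.toFinset (by simpa using hAB) hf
  have h2 := h1.comp (φ := fun x : hA.toFinset → ℝ => g fun c => x ⟨c, by simp⟩)
    (ψ := fun x : hB.toFinset → ℝ => k fun c => x ⟨c, by simp⟩) (by fun_prop) (by fun_prop)
  exact h2.congr hg'.symm hk'.symm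

end AEFunctionOf

/-! ### One training step in the Gaussian data model. -/

section TrainingStep

open Module
open scoped RealInnerProductSpace

variable {T p n M : ℕ}

/-- The samples of the datasets `h ∈ H` of task `t`. -/
abbrev SampleIdx (n M t : ℕ) (H : Finset ℕ) : Type := Σ h : H, Fin (size n M t h)

/-- The feature vectors of the datasets `h ∈ H` of task `t`. -/
def samples (X : Features p n M) (t : ℕ) (H : Finset ℕ) (c : SampleIdx n M t H) :
    EuclideanSpace ℝ (Fin p) :=
  WithLp.toLp 2 fun i => X t c.1 i c.2

lemma inner_samples (X : Features p n M) (t : ℕ) (H : Finset ℕ) (c : SampleIdx n M t H)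
    (w : EuclideanSpace ℝ (Fin p)) :
    ⟪samples X t H c, w⟫ = ((X t c.1)ᵀ *ᵥ w.ofLp) c.2 := by
  simp [samples, PiLp.inner_apply, Matrix.mulVec, dotProduct, mul_comm]

lemma setOf_forall_mem_fits (X : Features p n M) (Y : Outputs n M) (t : ℕ) (H : Finset ℕ) :
    {w | ∀ h ∈ H, w ∈ fits X Y t h} = {w | ∀ c : SampleIdx n M t H,
      ⟪samples X t H c, w⟫ = Y t c.1 c.2} := by
  ext w
  simp only [inner_samples, fits, Set.mem_ofPred_eq, funext_iff]
  exact ⟨fun hw c => hw c.1 c.1.2 c.2, fun hw h hh s => hw ⟨⟨h, hh⟩, s⟩⟩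

variable {Ω : Type*} [MeasurableSpace Ω] {P : Measure Ω} {σ : ℝ≥0}
  {X : Ω → Features p n M} {z : Ω → Outputs n M}

instance : Finite (DatasetIdx T) :=
  Set.Finite.to_subtype (((Set.finite_Iic T).prod (Set.finite_Iio T)).subset fun _ hd =>
    ⟨hd.2.1, hd.2.2.trans_le hd.2.1⟩)

lemma IsGaussianData.aemeasurable_scalar (hdata : IsGaussianData P T p n M σ X z)
    (c : ScalarIdx T p n M) : AEMeasurable (scalar X z c) P := by
  obtain ⟨⟨d, h1, h2, h3⟩, (⟨i, s⟩ | s)⟩ := c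
  · exact (hdata.feature_law d.1 d.2 h1 h2 h3 i s).aemeasurable
  · exact (hdata.noise_law d.1 d.2 h1 h2 h3 s).aemeasurable

variable {t : ℕ} {H : Finset ℕ}

/-- The dataset `h ∈ H` of task `t` as an index. -/
def datasetIdx (ht1 : 1 ≤ t) (htT : t ≤ T) (hH : ∀ h ∈ H, h < t) (h : H) : DatasetIdx T :=
  ⟨(t, h), ht1, htT, hH h h.2⟩

/-- The entries form an injectively reindexed subfamily of the independent scalars, so their joint
law is a product of real Gaussians. Currying groups them into coordinate vectors, each of which is
standard Gaussian. -/
lemma IsGaussianData.hasLaw_samples (hdata : IsGaussianData P T p n M σ X z) (ht1 : 1 ≤ t)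
    (htT : t ≤ T) (hH : ∀ h ∈ H, h < t) :
    HasLaw (fun ω => samples (X ω) t H)
      (gaussianFamily (SampleIdx n M t H) (EuclideanSpace ℝ (Fin p))) P := by
  let e : (Σ _ : SampleIdx n M t H, Fin p) → ScalarIdx T p n M := fun c =>
    ⟨datasetIdx ht1 htT hH c.1.1, Sum.inl (c.2, c.1.2)⟩
  have he : Function.Injective e := by
    rintro ⟨⟨⟨h, hh⟩, s⟩, i⟩ ⟨⟨⟨h', hh'⟩, s'⟩, i'⟩ heq
    simp only [e, datasetIdx, Sigma.mk.injEq, Subtype.mk.injEq, Prod.mk.injEq, true_and] at heq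
    obtain ⟨rfl, heq⟩ := heq
    simp_all
  have h1 : HasLaw (fun ω c => scalar X z (e c) ω) (Measure.pi fun _ => gaussianReal 0 1) P :=
    iIndepFun.hasLaw_pi
      (fun c => hdata.feature_law t c.1.1 ht1 htT (hH _ c.1.1.2) c.2 c.1.2)
      (hdata.indep.precomp he)
  have h2 : HasLaw (MeasurableEquiv.piCurry fun (_ : SampleIdx n M t H) (_ : Fin p) => ℝ)
      (Measure.pi fun _ : SampleIdx n M t H => Measure.pi fun _ : Fin p => gaussianReal 0 1)
      (Measure.pi fun _ => gaussianReal 0 1) := by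
    refine ⟨(MeasurableEquiv.piCurry _).measurable.aemeasurable, ?_⟩
    have h3 := Measure.infinitePi_map_piCurry
      (fun (_ : SampleIdx n M t H) (_ : Fin p) => gaussianReal 0 1)
    simp_rw [Measure.infinitePi_eq_pi] at h3
    exact h3
  have h4 : HasLaw (fun (x : SampleIdx n M t H → Fin p → ℝ) c => WithLp.toLp 2 (x c))
      (gaussianFamily (SampleIdx n M t H) (EuclideanSpace ℝ (Fin p)))
      (Measure.pi fun _ : SampleIdx n M t H => Measure.pi fun _ : Fin p => gaussianReal 0 1) := by
    refine ⟨Measurable.aemeasurable (by fun_prop), ?_⟩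
    rw [Measure.pi_map_pi (fun _ => Measurable.aemeasurable (by fun_prop))]
    simp_rw [map_pi_eq_stdGaussian]
    rfl
  exact (h4.comp h2).comp h1

lemma aeFunctionOf_samples (ht1 : 1 ≤ t) (htT : t ≤ T) (hH : ∀ h ∈ H, h < t) :
    AEFunctionOf P (scalar (T := T) X z) {c | c.1.1.1 = t ∧ c.1.1.2 ∈ H ∧ c.2.isLeft}
      fun ω => samples (X ω) t H :=
  ⟨fun x c => WithLp.toLp 2 fun i =>
      x ⟨⟨datasetIdx ht1 htT hH c.1, Sum.inl (i, c.2)⟩, rfl, c.1.2, rfl⟩,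
    by fun_prop, ae_of_all _ fun _ => rfl⟩

lemma aeFunctionOf_noise (ht1 : 1 ≤ t) (htT : t ≤ T) (hH : ∀ h ∈ H, h < t) :
    AEFunctionOf P (scalar (T := T) X z) {c | c.1.1.1 = t ∧ c.1.1.2 ∈ H ∧ ¬c.2.isLeft}
      fun ω (c : SampleIdx n M t H) => z ω t c.1 c.2 :=
  ⟨fun x c => x ⟨⟨datasetIdx ht1 htT hH c.1, Sum.inr c.2⟩, rfl, c.1.2, Bool.false_ne_true⟩,
    by fun_prop, ae_of_all _ fun _ => rfl⟩

lemma IsGaussianData.memLp_noise (hdata : IsGaussianData P T p n M σ X z) (ht1 : 1 ≤ t)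
    (htT : t ≤ T) (hH : ∀ h ∈ H, h < t) (c : SampleIdx n M t H) :
    MemLp (fun ω => z ω t c.1 c.2) 2 P := by
  have h1 := hdata.noise_law t c.1 ht1 htT (hH _ c.1.2) c.2
  have h2 := memLp_id_gaussianReal (μ := 0) (v := σ ^ 2) 2
  rw [← h1.map_eq] at h2
  exact h2.comp_of_map h1.aemeasurable

lemma IsGaussianData.integral_noise (hdata : IsGaussianData P T p n M σ X z) (ht1 : 1 ≤ t)
    (htT : t ≤ T) (hH : ∀ h ∈ H, h < t) (c : SampleIdx n M t H) :
    ∫ ω, z ω t c.1 c.2 ∂P = 0 := by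
  rw [(hdata.noise_law t c.1 ht1 htT (hH _ c.1.2) c.2).integral_eq, integral_id_gaussianReal]

lemma IsGaussianData.integral_noise_mul_noise (hdata : IsGaussianData P T p n M σ X z)
    (ht1 : 1 ≤ t) (htT : t ≤ T) (hH : ∀ h ∈ H, h < t) (c c' : SampleIdx n M t H) :
    ∫ ω, z ω t c.1 c.2 * z ω t c'.1 c'.2 ∂P = if c = c' then (σ : ℝ) ^ 2 else 0 := by
  split_ifs with hc
  · subst hc
    have h1 := hdata.noise_law t c.1 ht1 htT (hH _ c.1.2) c.2
    have h2 := h1.variance_eq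
    rw [variance_id_gaussianReal, variance_of_integral_eq_zero h1.aemeasurable
      (hdata.integral_noise ht1 htT hH c)] at h2
    simpa [sq] using h2
  · have hne : (⟨datasetIdx ht1 htT hH c.1, Sum.inr c.2⟩ : ScalarIdx T p n M)
        ≠ ⟨datasetIdx ht1 htT hH c'.1, Sum.inr c'.2⟩ := by
      intro heq
      apply hc
      obtain ⟨⟨h, hh⟩, s⟩ := c
      obtain ⟨⟨h', hh'⟩, s'⟩ := c'
      simp only [datasetIdx, Sigma.mk.injEq, Subtype.mk.injEq, Prod.mk.injEq, true_and] at heq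
      obtain ⟨rfl, heq⟩ := heq
      simp_all
    have hind := hdata.indep.indepFun hne
    have h1 := hind.integral_fun_mul_eq_mul_integral
      (hdata.memLp_noise ht1 htT hH c).aestronglyMeasurable
      (hdata.memLp_noise ht1 htT hH c').aestronglyMeasurable
    refine h1.trans ?_
    have h2 := hdata.integral_noise ht1 htT hH c
    change (∫ ω, z ω t c.1 c.2 ∂P) * _ = 0
    rw [h2, zero_mul]

lemma labels_apply (wstar : ℕ → EuclideanSpace ℝ (Fin p)) (X : Features p n M) (z : Outputs n M)
    (c : SampleIdx n M t H) :
    labels wstar X z t c.1 c.2 = ⟪samples X t H c, wstar (taskOf t c.1)⟫ + z t c.1 c.2 := by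
  rw [inner_samples]
  rfl

lemma sum_sampleIdx (f : ℕ → ℝ) :
    ∑ c : SampleIdx n M t H, f c.1 = ∑ h ∈ H, size n M t h * f h := by
  rw [Fintype.sum_sigma]
  simp only [Finset.sum_const, Finset.card_univ, Fintype.card_fin, nsmul_eq_mul]
  exact Finset.sum_coe_sort H fun h => (size n M t h : ℝ) * f h

lemma card_sampleIdx : Fintype.card (SampleIdx n M t H) = ∑ h ∈ H, size n M t h := by
  rw [Fintype.card_sigma]
  simp only [Fintype.card_fin]
  exact Finset.sum_coe_sort H fun h => size n M t h

/-- One training step: fitting the datasets `h ∈ H` of task `t`, none of which was used before. -/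
lemma IsGaussianData.fit_datasets [IsProbabilityMeasure P]
    (hdata : IsGaussianData P T p n M σ X z) (ht1 : 1 ≤ t) (htT : t ≤ T) (hH : ∀ h ∈ H, h < t)
    (hN : ∑ h ∈ H, size n M t h + 1 < p) (wstar : ℕ → EuclideanSpace ℝ (Fin p))
    {D : Set (ℕ × ℕ)} (hD : ∀ h ∈ H, (t, h) ∉ D) {w w' : Ω → EuclideanSpace ℝ (Fin p)}
    (hw : AEFunctionOf P (scalar (T := T) X z) {c | c.1.1 ∈ D} w)
    (hw2 : ∀ i, Integrable (fun ω => modelError wstar i (w ω)) P)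
    (hw' : ∀ ω, w' ω = closestPoint
      {v | ∀ h ∈ H, v ∈ fits (X ω) (labels wstar (X ω) (z ω)) t h} (w ω)) :
    AEFunctionOf P (scalar (T := T) X z) {c | c.1.1 ∈ D ∪ {d | d.1 = t ∧ d.2 ∈ H}} w' ∧
    ∀ i, Integrable (fun ω => modelError wstar i (w' ω)) P ∧
      ∫ ω, modelError wstar i (w' ω) ∂P
        = (1 - (∑ h ∈ H, size n M t h : ℕ) / p) * ∫ ω, modelError wstar i (w ω) ∂P
          + 1 / p * ∑ h ∈ H, size n M t h * ‖wstar (taskOf t h) - wstar i‖ ^ 2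
          + 1 / (2 * p * ((p : ℝ) - (∑ h ∈ H, size n M t h : ℕ) - 1))
            * ∑ h ∈ H, ∑ h' ∈ H, (size n M t h : ℝ) * size n M t h'
              * ‖wstar (taskOf t h) - wstar (taskOf t h')‖ ^ 2
          + (∑ h ∈ H, size n M t h : ℕ) * (σ : ℝ) ^ 2
            / ((p : ℝ) - (∑ h ∈ H, size n M t h : ℕ) - 1) := by
  have hV := hdata.hasLaw_samples ht1 htT hH
  have hcard : Fintype.card (SampleIdx n M t H) + 1
      < finrank ℝ (EuclideanSpace ℝ (Fin p)) := by
    rw [card_sampleIdx, finrank_euclideanSpace_fin]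
    exact hN
  set V := fun ω => samples (X ω) t H
  set ζ := fun ω (c : SampleIdx n M t H) => z ω t c.1 c.2
  set u := fun c : SampleIdx n M t H => wstar (taskOf t c.1)
  have hupd : w' =ᵐ[P] fun ω => fitUpdate (V ω) (fun c => ⟪V ω c, u c⟫ + ζ ω c) (w ω) := by
    have h1 := ae_linearIndependent_gaussianFamily (ι := SampleIdx n M t H)
      (F := EuclideanSpace ℝ (Fin p)) (by omega)
    rw [← hV.map_eq] at h1
    filter_upwards [ae_of_ae_map hV.aemeasurable h1] with ω hω
    rw [hw', setOf_forall_mem_fits]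
    simp_rw [labels_apply]
    exact closestPoint_eq_fitUpdate hω _ _
  have hsc := hdata.aemeasurable_scalar
  have hVf := aeFunctionOf_samples (P := P) (X := X) (z := z) ht1 htT hH
  have hζf := aeFunctionOf_noise (P := P) (X := X) (z := z) ht1 htT hH
  -- Freshness of the data: `w` depends only on datasets in `D`, which contains none of those being
  -- fitted.
  have hwV : IndepFun w V P := by
    refine hw.indepFun hVf ?_ hsc hdata.indep
    rw [Set.disjoint_left]
    rintro ⟨⟨⟨t', h'⟩, _⟩, _⟩ h1 ⟨rfl, h2, _⟩
    exact hD h' h2 h1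
  have hVζ : IndepFun V ζ P := by
    refine hVf.indepFun hζf ?_ hsc hdata.indep
    rw [Set.disjoint_left]
    exact fun c h1 h2 => h2.2.2 h1.2.2
  constructor
  · refine AEFunctionOf.congr ?_ hupd
    have h1 : AEFunctionOf P (scalar (T := T) X z)
        {c | c.1.1 ∈ D ∪ {d | d.1 = t ∧ d.2 ∈ H}} fun ω => (w ω, V ω, ζ ω) :=
      (hw.mono fun c hc => Or.inl hc).prodMk
        ((hVf.mono fun c hc => Or.inr ⟨hc.1, hc.2.1⟩).prodMk
          (hζf.mono fun c hc => Or.inr ⟨hc.1, hc.2.1⟩))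
    refine h1.comp (φ := fun q => fitUpdate q.2.1 (fun c => ⟪q.2.1 c, u c⟫ + q.2.2 c) q.1) ?_
    unfold fitUpdate
    fun_prop
  · intro i
    obtain ⟨h1, h2⟩ := integral_norm_sq_fitUpdate_sub hV hcard hVζ
      (hdata.memLp_noise ht1 htT hH) (hdata.integral_noise ht1 htT hH)
      (hdata.integral_noise_mul_noise ht1 htT hH)
      (hw.aemeasurable hsc).aestronglyMeasurable hwV u (wstar i) (hw2 i)
    have h3 : (fun ω => modelError wstar i (w' ω)) =ᵐ[P] fun ω =>
        ‖fitUpdate (V ω) (fun c => ⟪V ω c, u c⟫ + ζ ω c) (w ω) - wstar i‖ ^ 2 :=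
      hupd.mono fun ω hω => by simp only [modelError]; rw [hω]
    refine ⟨h1.congr h3.symm, ?_⟩
    rw [integral_congr_ae h3, h2, card_sampleIdx, finrank_euclideanSpace_fin]
    have h4 : ∑ c, ‖u c - wstar i‖ ^ 2
        = ∑ h ∈ H, size n M t h * ‖wstar (taskOf t h) - wstar i‖ ^ 2 :=
      sum_sampleIdx fun h => ‖wstar (taskOf t h) - wstar i‖ ^ 2
    have h5 : ∑ c, ∑ c', ‖u c - u c'‖ ^ 2
        = ∑ h ∈ H, ∑ h' ∈ H, (size n M t h : ℝ) * size n M t h'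
              * ‖wstar (taskOf t h) - wstar (taskOf t h')‖ ^ 2 := by
      have h6 : ∀ c, ∑ c', ‖u c - u c'‖ ^ 2 = ∑ h' ∈ H, (size n M t h' : ℝ)
          * ‖wstar (taskOf t c.1) - wstar (taskOf t h')‖ ^ 2 := fun c =>
        sum_sampleIdx fun h' => ‖wstar (taskOf t c.1) - wstar (taskOf t h')‖ ^ 2
      simp_rw [h6]
      rw [sum_sampleIdx fun h => ∑ h' ∈ H, (size n M t h' : ℝ)
          * ‖wstar (taskOf t h) - wstar (taskOf t h')‖ ^ 2]
      simp_rw [Finset.mul_sum, mul_assoc]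
    rw [h4, h5]
    rfl

end TrainingStep

/-! ### Recursions in `t` for the coefficients. -/

section Coefficients

variable {p n M T t : ℕ}

/-- The number of samples of task `j` that are used at task `t`. -/
noncomputable def taskSize (n M t j : ℕ) : ℝ :=
  if j = t then (n : ℝ) else if j < t then (M : ℝ) / ((t : ℝ) - 1) else 0

lemma cast_div_of_dvd (h : t ∣ M) : ((M / t : ℕ) : ℝ) = (M : ℝ) / t := by
  rcases Nat.eq_zero_or_pos t with rfl | ht
  · simp
  · exact Nat.cast_div h (by positivity)

/-- Regroups the datasets of a task by the task that generated them. Later tasks get weight zero, so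
the range `1, …, T` does not depend on `t` and the recursion can be compared term by term. -/
lemma sum_size_mul (hdvd : t ∣ M) (hT : t + 1 ≤ T) (f : ℕ → ℝ) :
    ∑ h ∈ Finset.range (t + 1), (size n M (t + 1) h : ℝ) * f (taskOf (t + 1) h)
      = ∑ j ∈ Finset.Icc 1 T, taskSize n M (t + 1) j * f j := by
  have h1 : ∑ j ∈ Finset.Icc 1 T, taskSize n M (t + 1) j * f j
      = ∑ j ∈ Finset.Icc 1 (t + 1), taskSize n M (t + 1) j * f j := by
    refine (Finset.sum_subset (Finset.Icc_subset_Icc_right hT) fun j hj hj' => ?_).symm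
    have h2 : t + 1 < j := by
      simp only [Finset.mem_Icc] at hj hj'
      omega
    simp [taskSize, h2.ne', h2.not_gt]
  rw [h1, Finset.sum_Icc_succ_top (by omega), Finset.sum_range_succ', Finset.range_eq_Ico,
    Finset.sum_Ico_add' (fun h => (size n M (t + 1) h : ℝ) * f (taskOf (t + 1) h)) 0 t 1]
  congr 1
  · rw [zero_add]
    refine Finset.sum_congr (by ext j; simp) fun j hj => ?_
    obtain ⟨hj1, hj2⟩ := Finset.mem_Icc.1 hj
    obtain ⟨j, rfl⟩ := Nat.exists_eq_add_of_le' hj1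
    have h3 : j ≠ t := by omega
    simp [size, taskOf, taskSize, h3, show j < t by omega, cast_div_of_dvd hdvd]
  · simp [size, taskOf, taskSize]

lemma sum_size (hdvd : t ∣ M) :
    ∑ h ∈ Finset.range (t + 1), size n M (t + 1) h = n + if t = 0 then 0 else M := by
  rw [Finset.sum_range_succ', add_comm]
  split_ifs with ht
  · simp [ht, size]
  · simp [size, Nat.mul_div_cancel' hdvd]

lemma sum_sum_eq_two_mul {s : Finset ℕ} {g : ℕ → ℕ → ℝ} (hsymm : ∀ j k, g j k = g k j)
    (hdiag : ∀ j, g j j = 0) :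
    ∑ j ∈ s, ∑ k ∈ s, g j k = 2 * ∑ j ∈ s, ∑ k ∈ s, if j < k then g j k else 0 := by
  have h1 : ∀ j k, g j k = (if j < k then g j k else 0) + if k < j then g k j else 0 := by
    intro j k
    rcases lt_trichotomy j k with h | rfl | h
    · simp [h, h.not_gt]
    · simp [hdiag]
    · simp [h, h.not_gt, hsymm j k]
  conv_lhs => enter [2, j, 2, k]; rw [h1]
  simp_rw [Finset.sum_add_distrib]
  rw [Finset.sum_comm (f := fun j k => if k < j then g k j else 0)]
  ring

/-- This shift invariance drives the recursions: splitting off `l = 0` in a formula for `t + 1`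
leaves the formula for `t`. -/
lemma bCoef_succ_succ (l : ℕ) : bCoef p M (l + 1) (t + 1) = bCoef p M l t := by
  simp [bCoef, add_sub_add_right_eq_sub]

lemma hCoef_succ_succ (l : ℕ) : hCoef p n M (l + 1) (t + 1) = hCoef p n M l t := by
  rw [hCoef, hCoef, bCoef_succ_succ]

lemma bCoef_zero_succ : bCoef p M 0 (t + 1) = (M : ℝ) / t / p := by
  rcases Nat.eq_zero_or_pos t with rfl | ht
  · simp [bCoef]
  · simp [bCoef, ht.ne', div_div]

lemma taskSize_self (j : ℕ) : taskSize n M j j = n := by simp [taskSize]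

lemma taskSize_of_le {j : ℕ} (h : j ≤ t) : taskSize n M (t + 1) j = (M : ℝ) / t := by
  simp [taskSize, show j ≠ t + 1 by omega, show j < t + 1 by omega]

lemma taskSize_of_lt {j : ℕ} (h : t < j) : taskSize n M t j = 0 := by
  simp [taskSize, show j ≠ t by omega, show ¬j < t by omega]

/-- The part of the coefficient of `‖w_j* - w_i*‖ ^ 2` for concurrent rehearsal that comes from
fitting samples of task `j`. -/
noncomputable def directConc (p n M j t : ℕ) : ℝ :=
  if j ≤ t then (1 - rCoef p n 0) * rCoef p n M ^ (t - j)
    + ∑ l ∈ Finset.range (t - j), rCoef p n M ^ l * bCoef p M l t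
  else 0

lemma directConc_succ (j : ℕ) :
    directConc p n M j (t + 1)
      = rCoef p n M * directConc p n M j t + taskSize n M (t + 1) j / p := by
  rcases lt_trichotomy j (t + 1) with h | rfl | h
  · have h1 : t + 1 - j = (t - j) + 1 := by omega
    rw [directConc, directConc, if_pos h.le, if_pos (by omega), h1, Finset.sum_range_succ',
      taskSize_of_le (by omega), bCoef_zero_succ]
    simp_rw [bCoef_succ_succ, pow_succ']
    rw [mul_add, Finset.mul_sum]
    simp_rw [mul_assoc]
    ring
  · rw [directConc, directConc, if_pos le_rfl, if_neg (by omega), taskSize_self]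
    simp [rCoef]
  · rw [directConc, directConc, if_neg (by omega), if_neg (by omega), taskSize_of_lt h]
    simp

/-- The new summand at `l = 0` pairs two memory datasets when `k ≤ t`, since `p * B` is the size of
one. For `k = t + 1` the current dataset contributes the factor `n`. Each pair is counted once, at
`j < k`, which absorbs the `1 / 2` from polarization. -/
lemma crossConc_succ (hp : 0 < p) (j k : ℕ) :
    crossConc p n M j k (t + 1) = rCoef p n M * crossConc p n M j k t
      + (if j < k then taskSize n M (t + 1) j * taskSize n M (t + 1) k
          / (p * ((p : ℝ) - (n + M : ℕ) - 1)) else 0) := by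
  have hp' : (p : ℝ) ≠ 0 := by positivity
  have hg : (p : ℝ) - n - M - 1 = (p : ℝ) - (n + M : ℕ) - 1 := by push_cast; ring
  by_cases hjk : j < k
  swap
  · simp [crossConc, hjk]
  rw [if_pos hjk]
  rcases lt_trichotomy k (t + 1) with h | rfl | h
  · have h1 : t + 1 - k = (t - k) + 1 := by omega
    rw [crossConc, crossConc, if_pos ⟨hjk, h.le⟩, if_pos ⟨hjk, by omega⟩, h1,
      Finset.sum_range_succ', taskSize_of_le (by omega), taskSize_of_le (by omega),
      hCoef_succ_succ]
    simp_rw [bCoef_succ_succ, hCoef_succ_succ, pow_succ']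
    rw [hCoef, bCoef_zero_succ, hg, mul_add, Finset.mul_sum]
    have h2 : ∀ l ∈ Finset.range (t - k),
        rCoef p n M * (p * rCoef p n M ^ l * bCoef p M l t * hCoef p n M l t)
          = p * (rCoef p n M * rCoef p n M ^ l) * bCoef p M l t * hCoef p n M l t :=
      fun l _ => by ring
    rw [Finset.sum_congr rfl h2]
    field_simp
    ring
  · rw [crossConc, crossConc, if_pos ⟨hjk, le_rfl⟩, if_neg (by omega), taskSize_self,
      taskSize_of_le (by omega), Nat.sub_self, hCoef, bCoef_zero_succ, hg]
    simp only [Finset.range_zero, Finset.sum_empty, pow_zero]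
    field_simp
    ring
  · rw [crossConc, crossConc, if_neg (by omega), if_neg (by omega), taskSize_of_lt h]
    simp

lemma d0Conc_succ (ht : 1 ≤ t) : d0Conc p n M (t + 1) = rCoef p n M * d0Conc p n M t := by
  obtain ⟨t, rfl⟩ := Nat.exists_eq_add_of_le' ht
  simp only [d0Conc, Nat.add_sub_cancel, pow_succ]
  ring

lemma noiseConc_succ (ht : 1 ≤ t) (σ : ℝ) :
    noiseConc p n M (t + 1) σ
      = rCoef p n M * noiseConc p n M t σ + lambdaCoef p ((n : ℝ) + M) σ := by
  obtain ⟨t, rfl⟩ := Nat.exists_eq_add_of_le' ht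
  simp only [noiseConc, Nat.add_sub_cancel]
  rw [Finset.sum_range_succ']
  simp_rw [pow_succ']
  rw [mul_add, Finset.mul_sum]
  simp_rw [mul_assoc]
  ring

/-- Regrouping of the sum over the coefficients `d_{ijkt}` for concurrent rehearsal. -/
lemma sum_dConc {D : ℕ → ℕ → ℝ} (hsymm : ∀ j k, D j k = D k j) (hdiag : ∀ j, D j j = 0) {i : ℕ}
    (hi : i ∈ Finset.Icc 1 T) :
    ∑ j ∈ Finset.Icc 1 T, ∑ k ∈ Finset.Icc 1 T, dConc p n M i j k t * D j k
      = ∑ j ∈ Finset.Icc 1 T, directConc p n M j t * D j i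
        + ∑ j ∈ Finset.Icc 1 T, ∑ k ∈ Finset.Icc 1 T, crossConc p n M j k t * D j k := by
  set f : ℕ → ℕ → ℝ := fun j k => crossConc p n M j k t * D j k
  -- The row `f i ·` is recorded at `k = i` and removed at `j = i`, so the double sum of `f` is
  -- unchanged.
  have h1 : ∀ j k, dConc p n M i j k t * D j k
      = (if k = i then directConc p n M j t * D j i else 0) + (if k = i then f i j else 0)
        + (f j k - if j = i then f i k else 0) := by
    intro j k
    by_cases hk : k = i
    · subst hk
      have h2 : crossConc p n M (min k j) (max k j) t * D j k
          = f k j + (f j k - if j = k then f k k else 0) := by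
        rcases lt_trichotomy j k with h | rfl | h
        · simp [f, h.ne, min_eq_right h.le, max_eq_left h.le, crossConc, h.not_gt]
        · simp [f, hdiag]
        · simp [f, h.ne', min_eq_left h.le, max_eq_right h.le, crossConc, h.not_gt, hsymm j k]
      rw [dConc, if_pos rfl, if_pos rfl, if_pos rfl, add_mul, h2, directConc]
      ring
    · rw [dConc, if_neg hk, if_neg hk, if_neg hk]
      by_cases hj : j = i
      · simp [hj]
      · simp [hj, f]
  simp_rw [h1, Finset.sum_add_distrib, Finset.sum_sub_distrib]
  rw [Finset.sum_comm (f := fun j k => if j = i then f i k else 0)]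
  simp only [Finset.sum_ite_eq', hi, if_true]
  ring

/-- The coefficient of `‖w_j* - w_i*‖ ^ 2` for sequential rehearsal. -/
noncomputable def directSeq (p n M j t : ℕ) : ℝ :=
  if j ≤ t then
    (1 - rCoef p n 0) * (1 - bCoef p M (t - j) t) ^ (j - 1) * deltaCoef p n M t (t - j)
      + ∑ l ∈ Finset.range (t - j),
          deltaCoef p n M t l * (1 - bCoef p M l t) ^ (t - j - l - 1) * bCoef p M l t
  else 0

lemma deltaCoef_succ_succ (a : ℕ) :
    deltaCoef p n M (t + 1) (a + 1)
      = (1 - bCoef p M 0 (t + 1)) ^ t * rCoef p n 0 * deltaCoef p n M t a := by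
  rw [deltaCoef, Finset.prod_range_succ', mul_comm, deltaCoef]
  simp only [bCoef_succ_succ, Nat.add_sub_add_right]
  simp

/-- The older contributions are damped by the fit to the current data and by `t` memory fits. The
new contribution of memory task `j` is damped only by the `t - j` fits after it. -/
lemma directSeq_succ (j : ℕ) :
    directSeq p n M j (t + 1)
      = (1 - bCoef p M 0 (t + 1)) ^ t * rCoef p n 0 * directSeq p n M j t
        + (if j = t + 1 then (1 - bCoef p M 0 (t + 1)) ^ t * ((n : ℝ) / p)
            else if j ≤ t then (1 - bCoef p M 0 (t + 1)) ^ (t - j) * bCoef p M 0 (t + 1) else 0) := by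
  rcases lt_trichotomy j (t + 1) with h | rfl | h
  · have h1 : t + 1 - j = (t - j) + 1 := by omega
    rw [directSeq, directSeq, if_pos h.le, if_pos (by omega), if_neg h.ne, if_pos (by omega), h1,
      Finset.sum_range_succ']
    simp_rw [deltaCoef_succ_succ, bCoef_succ_succ, Nat.add_sub_add_right]
    rw [mul_add, Finset.mul_sum]
    have h2 : ∀ l ∈ Finset.range (t - j),
        (1 - bCoef p M 0 (t + 1)) ^ t * rCoef p n 0 * deltaCoef p n M t l
            * (1 - bCoef p M l t) ^ (t - j - l - 1) * bCoef p M l t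
          = (1 - bCoef p M 0 (t + 1)) ^ t * rCoef p n 0 * (deltaCoef p n M t l
            * (1 - bCoef p M l t) ^ (t - j - l - 1) * bCoef p M l t) :=
      fun l _ => by ring
    rw [Finset.sum_congr rfl h2]
    simp only [deltaCoef, Finset.range_zero, Finset.prod_empty, Nat.sub_zero,
      Nat.add_sub_cancel]
    ring
  · rw [directSeq, directSeq, if_pos le_rfl, if_neg (by omega), if_pos rfl]
    simp [rCoef, deltaCoef]
    ring
  · rw [directSeq, directSeq, if_neg (by omega), if_neg (by omega), if_neg (by omega),
      if_neg (by omega)]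
    simp

lemma d0Seq_succ (ht : 1 ≤ t) :
    d0Seq p n M (t + 1)
      = (1 - bCoef p M 0 (t + 1)) ^ t * rCoef p n 0 * d0Seq p n M t := by
  obtain ⟨t, rfl⟩ := Nat.exists_eq_add_of_le' ht
  simp only [d0Seq, Nat.add_sub_cancel, deltaCoef_succ_succ]
  ring

lemma noiseSeq_succ (ht : 1 ≤ t) (σ : ℝ) :
    noiseSeq p n M (t + 1) σ
      = (1 - bCoef p M 0 (t + 1)) ^ t * rCoef p n 0 * noiseSeq p n M t σ
        + ((1 - bCoef p M 0 (t + 1)) ^ t * lambdaCoef p n σ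
          + ∑ j ∈ Finset.Icc 1 t, (1 - bCoef p M 0 (t + 1)) ^ (t - j)
              * lambdaCoef p ((M : ℝ) / t) σ) := by
  obtain ⟨t, rfl⟩ := Nat.exists_eq_add_of_le' ht
  simp only [noiseSeq, Nat.add_sub_cancel]
  rw [Finset.sum_range_succ']
  simp_rw [deltaCoef_succ_succ, bCoef_succ_succ, Nat.add_sub_add_right]
  have h1 : ∀ l : ℕ, ((t + 1 + 1 : ℕ) : ℝ) - (l + 1 : ℕ) - 1 = ((t + 1 : ℕ) : ℝ) - l - 1 := by
    intro l
    push_cast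
    ring
  simp_rw [h1]
  have h2 : deltaCoef p n M (t + 1 + 1) 0 = 1 := by simp [deltaCoef]
  have h3 : ((t + 1 + 1 : ℕ) : ℝ) - (0 : ℕ) - 1 = ((t + 1 : ℕ) : ℝ) := by
    push_cast
    ring
  rw [h2, h3, one_mul, Nat.sub_zero, Nat.add_sub_cancel, mul_add, Finset.mul_sum, ← add_assoc]
  congr 2
  · ring
  · exact Finset.sum_congr rfl fun l _ => by ring

lemma sum_dSeq {D : ℕ → ℕ → ℝ} {i : ℕ} (hi : i ∈ Finset.Icc 1 T) :
    ∑ j ∈ Finset.Icc 1 T, ∑ k ∈ Finset.Icc 1 T, dSeq p n M i j k t * D j k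
      = ∑ j ∈ Finset.Icc 1 T, directSeq p n M j t * D j i := by
  refine Finset.sum_congr rfl fun j _ => ?_
  have h1 : ∀ k, dSeq p n M i j k t * D j k = if k = i then directSeq p n M j t * D j i else 0 := by
    intro k
    by_cases hk : k = i
    · subst hk
      simp [dSeq, directSeq]
    · simp [dSeq, hk]
  simp_rw [h1]
  simp only [Finset.sum_ite_eq', hi, if_true]

end Coefficients

/-! ### Expected errors of concurrent rehearsal. -/

section Concurrent

variable {p n M T : ℕ} {Ω : Type*} [MeasurableSpace Ω] {P : Measure Ω} [IsProbabilityMeasure P]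
  {σ : ℝ≥0} {X : Ω → Features p n M} {z : Ω → Outputs n M}

/-- The expected model error of concurrent rehearsal after task `t ≥ 1`. -/
noncomputable def errorConc (p n M T t : ℕ) (σ : ℝ) (wstar : ℕ → EuclideanSpace ℝ (Fin p))
    (i : ℕ) : ℝ :=
  d0Conc p n M t * ‖wstar i‖ ^ 2
    + (∑ j ∈ Finset.Icc 1 T, directConc p n M j t * ‖wstar j - wstar i‖ ^ 2
      + ∑ j ∈ Finset.Icc 1 T, ∑ k ∈ Finset.Icc 1 T,
          crossConc p n M j k t * ‖wstar j - wstar k‖ ^ 2)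
    + noiseConc p n M t σ

lemma errorConc_one (σ : ℝ) (hT : 1 ≤ T) (wstar : ℕ → EuclideanSpace ℝ (Fin p)) (i : ℕ) :
    errorConc p n M T 1 σ wstar i
      = rCoef p n 0 * ‖wstar i‖ ^ 2 + (n : ℝ) / p * ‖wstar 1 - wstar i‖ ^ 2
        + lambdaCoef p n σ := by
  have h1 : ∑ j ∈ Finset.Icc 1 T, directConc p n M j 1 * ‖wstar j - wstar i‖ ^ 2
      = (n : ℝ) / p * ‖wstar 1 - wstar i‖ ^ 2 := by
    rw [Finset.sum_eq_single 1]
    · simp [directConc, rCoef]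
    · intro j hj hj1
      have := (Finset.mem_Icc.1 hj).1
      rw [directConc, if_neg (by omega), zero_mul]
    · intro h
      simp [hT] at h
  have h2 : ∑ j ∈ Finset.Icc 1 T, ∑ k ∈ Finset.Icc 1 T,
      crossConc p n M j k 1 * ‖wstar j - wstar k‖ ^ 2 = 0 := by
    refine Finset.sum_eq_zero fun j hj => Finset.sum_eq_zero fun k _ => ?_
    have := (Finset.mem_Icc.1 hj).1
    rw [crossConc, if_neg (by omega), zero_mul]
  rw [errorConc, h1, h2, add_zero]
  simp [d0Conc, noiseConc]

lemma errorConc_succ {t : ℕ} (ht : 1 ≤ t) (hp : 0 < p) (σ : ℝ)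
    (wstar : ℕ → EuclideanSpace ℝ (Fin p)) (i : ℕ) :
    errorConc p n M T (t + 1) σ wstar i
      = rCoef p n M * errorConc p n M T t σ wstar i
        + 1 / p * ∑ j ∈ Finset.Icc 1 T, taskSize n M (t + 1) j * ‖wstar j - wstar i‖ ^ 2
        + 1 / (2 * p * ((p : ℝ) - (n + M : ℕ) - 1))
          * ∑ j ∈ Finset.Icc 1 T, ∑ k ∈ Finset.Icc 1 T, taskSize n M (t + 1) j
            * taskSize n M (t + 1) k * ‖wstar j - wstar k‖ ^ 2
        + lambdaCoef p ((n : ℝ) + M) σ := by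
  have h1 : ∑ j ∈ Finset.Icc 1 T, directConc p n M j (t + 1) * ‖wstar j - wstar i‖ ^ 2
      = rCoef p n M * ∑ j ∈ Finset.Icc 1 T, directConc p n M j t * ‖wstar j - wstar i‖ ^ 2
        + 1 / p * ∑ j ∈ Finset.Icc 1 T, taskSize n M (t + 1) j * ‖wstar j - wstar i‖ ^ 2 := by
    rw [Finset.mul_sum, Finset.mul_sum, ← Finset.sum_add_distrib]
    exact Finset.sum_congr rfl fun j _ => by rw [directConc_succ]; ring
  have h2 : ∑ j ∈ Finset.Icc 1 T, ∑ k ∈ Finset.Icc 1 T,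
        crossConc p n M j k (t + 1) * ‖wstar j - wstar k‖ ^ 2
      = rCoef p n M * ∑ j ∈ Finset.Icc 1 T, ∑ k ∈ Finset.Icc 1 T,
          crossConc p n M j k t * ‖wstar j - wstar k‖ ^ 2
        + 1 / (2 * p * ((p : ℝ) - (n + M : ℕ) - 1))
          * ∑ j ∈ Finset.Icc 1 T, ∑ k ∈ Finset.Icc 1 T, taskSize n M (t + 1) j
            * taskSize n M (t + 1) k * ‖wstar j - wstar k‖ ^ 2 := by
    rw [sum_sum_eq_two_mul (g := fun j k => taskSize n M (t + 1) j
      * taskSize n M (t + 1) k * ‖wstar j - wstar k‖ ^ 2)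
      (fun j k => by rw [norm_sub_rev]; ring) (fun j => by simp), ← mul_assoc]
    simp_rw [Finset.mul_sum]
    rw [← Finset.sum_add_distrib]
    refine Finset.sum_congr rfl fun j _ => ?_
    rw [← Finset.sum_add_distrib]
    refine Finset.sum_congr rfl fun k _ => ?_
    rw [crossConc_succ hp]
    split_ifs
    · simp only [div_eq_mul_inv, mul_inv]
      ring
    · ring
  rw [errorConc, h1, h2, d0Conc_succ ht, noiseConc_succ ht, errorConc]
  ring

/-- The induction also carries that the iterate depends only on data of tasks up to `t`, which
supplies independence from the next data. -/
lemma IsGaussianData.concurrent_error (hdata : IsGaussianData P T p n M σ X z)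
    (hM : ∀ t, 2 ≤ t → t ≤ T → (t - 1) ∣ M) (hp : n + M + 1 < p)
    (wstar : ℕ → EuclideanSpace ℝ (Fin p)) (t : ℕ) (htT : t ≤ T) :
    AEFunctionOf P (scalar (T := T) X z) {c | c.1.1 ∈ {d : ℕ × ℕ | d.1 ≤ t}}
      (fun ω => concurrent (X ω) (labels wstar (X ω) (z ω)) t) ∧
    ∀ i, Integrable
        (fun ω => modelError wstar i (concurrent (X ω) (labels wstar (X ω) (z ω)) t)) P ∧
      ∫ ω, modelError wstar i (concurrent (X ω) (labels wstar (X ω) (z ω)) t) ∂P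
        = if t = 0 then ‖wstar i‖ ^ 2 else errorConc p n M T t σ wstar i := by
  induction t with
  | zero =>
    refine ⟨AEFunctionOf.const 0, fun i => ?_⟩
    simp [concurrent, modelError]
  | succ t ih =>
    obtain ⟨ih1, ih2⟩ := ih (by omega)
    have hdvd : t ∣ M ∨ t = 0 := by
      rcases Nat.eq_zero_or_pos t with h | h
      · exact Or.inr h
      · exact Or.inl (by simpa using hM (t + 1) (by omega) htT)
    have hH : ∀ h ∈ Finset.range (t + 1), h < t + 1 := fun h hh => Finset.mem_range.1 hh
    have hsize : ∑ h ∈ Finset.range (t + 1), size n M (t + 1) h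
        = if t = 0 then n else n + M := by
      rcases hdvd with h | rfl
      · rw [sum_size h]
        split_ifs <;> rfl
      · simp [size]
    have hstep := hdata.fit_datasets (by omega) htT hH
      (by rw [hsize]; split_ifs <;> omega) wstar
      (D := {d | d.1 ≤ t}) (fun h _ => by simp) ih1 (fun i => (ih2 i).1)
      (w' := fun ω => concurrent (X ω) (labels wstar (X ω) (z ω)) (t + 1))
      (fun ω => by simp only [concurrent, Finset.mem_range])
    refine ⟨hstep.1.mono ?_, fun i => ⟨(hstep.2 i).1, ?_⟩⟩
    · rintro c (hc | ⟨hc, _⟩)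
      · exact le_trans hc (Nat.le_succ t)
      · exact le_of_eq hc
    · rw [(hstep.2 i).2, (ih2 i).2, if_neg (Nat.succ_ne_zero t), hsize]
      -- The first task has no memory and uses `n` samples instead of `n + M`, so it is the base
      -- case of the closed form.
      rcases Nat.eq_zero_or_pos t with rfl | ht
      · rw [errorConc_one _ htT]
        simp [size, taskOf, rCoef, lambdaCoef]
        ring
      · have hd : t ∣ M := hdvd.resolve_right ht.ne'
        rw [if_neg ht.ne', if_neg ht.ne', errorConc_succ ht (by omega),
          sum_size_mul hd htT fun j => ‖wstar j - wstar i‖ ^ 2]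
        have h1 : ∑ h ∈ Finset.range (t + 1), ∑ h' ∈ Finset.range (t + 1),
            (size n M (t + 1) h : ℝ) * size n M (t + 1) h'
              * ‖wstar (taskOf (t + 1) h) - wstar (taskOf (t + 1) h')‖ ^ 2
            = ∑ j ∈ Finset.Icc 1 T, ∑ k ∈ Finset.Icc 1 T, taskSize n M (t + 1) j
              * taskSize n M (t + 1) k * ‖wstar j - wstar k‖ ^ 2 := by
          simp_rw [mul_assoc, ← Finset.mul_sum]
          rw [← sum_size_mul hd htT fun j => ∑ k ∈ Finset.Icc 1 T, taskSize n M (t + 1) k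
            * ‖wstar j - wstar k‖ ^ 2]
          refine Finset.sum_congr rfl fun h _ => ?_
          rw [sum_size_mul hd htT fun k => ‖wstar (taskOf (t + 1) h) - wstar k‖ ^ 2]
        rw [h1]
        simp only [rCoef, lambdaCoef]
        push_cast
        ring

end Concurrent

/-! ### Expected errors of sequential rehearsal. -/

section Sequential

variable {p n M T : ℕ} {Ω : Type*} [MeasurableSpace Ω] {P : Measure Ω} [IsProbabilityMeasure P]
  {σ : ℝ≥0} {X : Ω → Features p n M} {z : Ω → Outputs n M}

/-- The expected model error of sequential rehearsal after task `t ≥ 1`. -/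
noncomputable def errorSeq (p n M T t : ℕ) (σ : ℝ) (wstar : ℕ → EuclideanSpace ℝ (Fin p))
    (i : ℕ) : ℝ :=
  d0Seq p n M t * ‖wstar i‖ ^ 2
    + ∑ j ∈ Finset.Icc 1 T, directSeq p n M j t * ‖wstar j - wstar i‖ ^ 2
    + noiseSeq p n M t σ

lemma errorSeq_one (σ : ℝ) (hT : 1 ≤ T) (wstar : ℕ → EuclideanSpace ℝ (Fin p)) (i : ℕ) :
    errorSeq p n M T 1 σ wstar i
      = rCoef p n 0 * ‖wstar i‖ ^ 2 + (n : ℝ) / p * ‖wstar 1 - wstar i‖ ^ 2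
        + lambdaCoef p n σ := by
  have h1 : ∑ j ∈ Finset.Icc 1 T, directSeq p n M j 1 * ‖wstar j - wstar i‖ ^ 2
      = (n : ℝ) / p * ‖wstar 1 - wstar i‖ ^ 2 := by
    rw [Finset.sum_eq_single 1]
    · simp [directSeq, rCoef, deltaCoef]
    · intro j hj hj1
      have := (Finset.mem_Icc.1 hj).1
      rw [directSeq, if_neg (by omega), zero_mul]
    · intro h
      simp [hT] at h
  rw [errorSeq, h1]
  simp [d0Seq, noiseSeq, deltaCoef]

lemma errorSeq_succ {t : ℕ} (ht : 1 ≤ t) (htT : t + 1 ≤ T) (σ : ℝ)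
    (wstar : ℕ → EuclideanSpace ℝ (Fin p)) (i : ℕ) :
    errorSeq p n M T (t + 1) σ wstar i
      = (1 - bCoef p M 0 (t + 1)) ^ t * (rCoef p n 0 * errorSeq p n M T t σ wstar i
          + (n : ℝ) / p * ‖wstar (t + 1) - wstar i‖ ^ 2 + lambdaCoef p n σ)
        + ∑ j ∈ Finset.Icc 1 t, (1 - bCoef p M 0 (t + 1)) ^ (t - j)
          * (bCoef p M 0 (t + 1) * ‖wstar j - wstar i‖ ^ 2 + lambdaCoef p ((M : ℝ) / t) σ) := by
  set B := bCoef p M 0 (t + 1)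
  have h1 : ∑ j ∈ Finset.Icc 1 T, directSeq p n M j (t + 1) * ‖wstar j - wstar i‖ ^ 2
      = (1 - B) ^ t * rCoef p n 0
          * ∑ j ∈ Finset.Icc 1 T, directSeq p n M j t * ‖wstar j - wstar i‖ ^ 2
        + ((1 - B) ^ t * ((n : ℝ) / p) * ‖wstar (t + 1) - wstar i‖ ^ 2
          + ∑ j ∈ Finset.Icc 1 t, (1 - B) ^ (t - j) * B * ‖wstar j - wstar i‖ ^ 2) := by
    have h2 : ∑ j ∈ Finset.Icc 1 T, (if j = t + 1 then (1 - B) ^ t * ((n : ℝ) / p)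
            else if j ≤ t then (1 - B) ^ (t - j) * B else 0) * ‖wstar j - wstar i‖ ^ 2
        = (1 - B) ^ t * ((n : ℝ) / p) * ‖wstar (t + 1) - wstar i‖ ^ 2
          + ∑ j ∈ Finset.Icc 1 t, (1 - B) ^ (t - j) * B * ‖wstar j - wstar i‖ ^ 2 := by
      rw [← Finset.sum_subset (Finset.Icc_subset_Icc_right htT) (fun j hj hj' => by
        simp only [Finset.mem_Icc] at hj hj'
        rw [if_neg (by omega), if_neg (by omega), zero_mul]),
        Finset.sum_Icc_succ_top (by omega), if_pos rfl, add_comm]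
      congr 1
      refine Finset.sum_congr rfl fun j hj => ?_
      have := (Finset.mem_Icc.1 hj).2
      rw [if_neg (by omega), if_pos this]
    rw [← h2, Finset.mul_sum, ← Finset.sum_add_distrib]
    exact Finset.sum_congr rfl fun j _ => by rw [directSeq_succ]; ring
  rw [errorSeq, h1, d0Seq_succ ht, noiseSeq_succ ht, errorSeq]
  simp_rw [mul_add, Finset.sum_add_distrib, ← mul_assoc]
  ring

/-- All samples of a single dataset share one ground truth, so the pairwise term of `fit_datasets`
is zero. -/
lemma IsGaussianData.fit_dataset (hdata : IsGaussianData P T p n M σ X z) {t h : ℕ}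
    (ht1 : 1 ≤ t) (htT : t ≤ T) (hh : h < t) (hN : size n M t h + 1 < p)
    (wstar : ℕ → EuclideanSpace ℝ (Fin p))
    {D : Set (ℕ × ℕ)} (hD : (t, h) ∉ D) {w : Ω → EuclideanSpace ℝ (Fin p)}
    (hw : AEFunctionOf P (scalar (T := T) X z) {c | c.1.1 ∈ D} w)
    (hw2 : ∀ i, Integrable (fun ω => modelError wstar i (w ω)) P) :
    AEFunctionOf P (scalar (T := T) X z) {c | c.1.1 ∈ D ∪ {(t, h)}}
      (fun ω => closestPoint (fits (X ω) (labels wstar (X ω) (z ω)) t h) (w ω)) ∧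
    ∀ i, Integrable (fun ω => modelError wstar i
        (closestPoint (fits (X ω) (labels wstar (X ω) (z ω)) t h) (w ω))) P ∧
      ∫ ω, modelError wstar i
          (closestPoint (fits (X ω) (labels wstar (X ω) (z ω)) t h) (w ω)) ∂P
        = (1 - (size n M t h : ℝ) / p) * ∫ ω, modelError wstar i (w ω) ∂P
          + (size n M t h : ℝ) / p * ‖wstar (taskOf t h) - wstar i‖ ^ 2
          + lambdaCoef p (size n M t h) σ := by
  have hstep := hdata.fit_datasets ht1 htT (H := {h}) (by simpa using hh) (by simpa using hN) wstar
    (D := D) (by simpa using hD) hw hw2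
    (w' := fun ω => closestPoint (fits (X ω) (labels wstar (X ω) (z ω)) t h) (w ω))
    (fun ω => by simp)
  refine ⟨hstep.1.mono ?_, fun i => ⟨(hstep.2 i).1, ?_⟩⟩
  · rintro c (hc | ⟨hc1, hc2⟩)
    · exact Or.inl hc
    · exact Or.inr (Prod.ext hc1 (by simpa using hc2))
  · rw [(hstep.2 i).2]
    simp [lambdaCoef]
    ring

/-- Unrolls the affine recursion inside one task: the fit to the current data comes first, and each
memory fit then contracts everything before it by `1 - B`. -/
lemma IsGaussianData.sequentialInner_error (hdata : IsGaussianData P T p n M σ X z) {t : ℕ}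
    (htT : t + 1 ≤ T) (hdvd : t ∣ M) (hn : n + 1 < p) (hM : M + 1 < p)
    (wstar : ℕ → EuclideanSpace ℝ (Fin p)) {w : Ω → EuclideanSpace ℝ (Fin p)}
    (hw : AEFunctionOf P (scalar (T := T) X z) {c | c.1.1 ∈ {d : ℕ × ℕ | d.1 ≤ t}} w)
    (hw2 : ∀ i, Integrable (fun ω => modelError wstar i (w ω)) P) (h : ℕ) (hh : h ≤ t) :
    AEFunctionOf P (scalar (T := T) X z)
      {c | c.1.1 ∈ {d : ℕ × ℕ | d.1 ≤ t ∨ d.1 = t + 1 ∧ d.2 ≤ h}}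
      (fun ω => sequentialInner (X ω) (labels wstar (X ω) (z ω)) (t + 1) (w ω) h) ∧
    ∀ i, Integrable (fun ω => modelError wstar i
        (sequentialInner (X ω) (labels wstar (X ω) (z ω)) (t + 1) (w ω) h)) P ∧
      ∫ ω, modelError wstar i
          (sequentialInner (X ω) (labels wstar (X ω) (z ω)) (t + 1) (w ω) h) ∂P
        = (1 - bCoef p M 0 (t + 1)) ^ h * (rCoef p n 0 * ∫ ω, modelError wstar i (w ω) ∂P
            + (n : ℝ) / p * ‖wstar (t + 1) - wstar i‖ ^ 2 + lambdaCoef p n σ)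
          + ∑ j ∈ Finset.Icc 1 h, (1 - bCoef p M 0 (t + 1)) ^ (h - j)
            * (bCoef p M 0 (t + 1) * ‖wstar j - wstar i‖ ^ 2 + lambdaCoef p ((M : ℝ) / t) σ) := by
  induction h with
  | zero =>
    have hstep := hdata.fit_dataset (t := t + 1) (h := 0) (by omega) htT (by omega)
      (by simpa [size] using hn) wstar (D := {d | d.1 ≤ t}) (by simp) hw hw2
    refine ⟨hstep.1.mono ?_, fun i => ⟨(hstep.2 i).1, ?_⟩⟩
    · rintro c (hc | hc)
      · exact Or.inl hc
      · exact Or.inr (by rw [Set.mem_singleton_iff.1 hc]; simp)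
    · refine (hstep.2 i).2.trans ?_
      simp [size, taskOf, rCoef]
  | succ h ih =>
    obtain ⟨ih1, ih2⟩ := ih (by omega)
    have hstep := hdata.fit_dataset (t := t + 1) (h := h + 1) (by omega) htT (by omega)
      -- Each memory dataset has at most `M` samples, so `M + 1 < p` suffices for every inner step.
      (by
        have := Nat.div_le_self M t
        simp only [size, Nat.add_sub_cancel]
        omega) wstar
      (D := {d | d.1 ≤ t ∨ d.1 = t + 1 ∧ d.2 ≤ h}) (by simp) ih1 (fun i => (ih2 i).1)
    refine ⟨hstep.1.mono ?_, fun i => ⟨(hstep.2 i).1, ?_⟩⟩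
    · rintro c ((hc | ⟨hc1, hc2⟩) | hc)
      · exact Or.inl hc
      · exact Or.inr ⟨hc1, Nat.le_succ_of_le hc2⟩
      · exact Or.inr (by rw [Set.mem_singleton_iff.1 hc]; simp)
    · refine (hstep.2 i).2.trans ?_
      rw [(ih2 i).2, Finset.sum_Icc_succ_top (by omega), Nat.sub_self]
      have h1 : ∀ j ∈ Finset.Icc 1 h, (1 - bCoef p M 0 (t + 1)) ^ (h + 1 - j)
            * (bCoef p M 0 (t + 1) * ‖wstar j - wstar i‖ ^ 2 + lambdaCoef p ((M : ℝ) / t) σ)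
          = (1 - bCoef p M 0 (t + 1)) * ((1 - bCoef p M 0 (t + 1)) ^ (h - j)
            * (bCoef p M 0 (t + 1) * ‖wstar j - wstar i‖ ^ 2
              + lambdaCoef p ((M : ℝ) / t) σ)) := by
        intro j hj
        rw [Nat.succ_sub (Finset.mem_Icc.1 hj).2, pow_succ]
        ring
      rw [Finset.sum_congr rfl h1, ← Finset.mul_sum]
      have h2 : ((size n M (t + 1) (h + 1) : ℕ) : ℝ) = (M : ℝ) / t := by
        simp only [size, Nat.add_sub_cancel, cast_div_of_dvd hdvd]
      rw [h2, ← bCoef_zero_succ]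
      simp only [taskOf]
      ring

lemma IsGaussianData.sequential_error (hdata : IsGaussianData P T p n M σ X z)
    (hdvd : ∀ t, 2 ≤ t → t ≤ T → (t - 1) ∣ M) (hn : n + 1 < p) (hM : M + 1 < p)
    (wstar : ℕ → EuclideanSpace ℝ (Fin p)) (t : ℕ) (htT : t ≤ T) :
    AEFunctionOf P (scalar (T := T) X z) {c | c.1.1 ∈ {d : ℕ × ℕ | d.1 ≤ t}}
      (fun ω => sequential (X ω) (labels wstar (X ω) (z ω)) t) ∧
    ∀ i, Integrable
        (fun ω => modelError wstar i (sequential (X ω) (labels wstar (X ω) (z ω)) t)) P ∧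
      ∫ ω, modelError wstar i (sequential (X ω) (labels wstar (X ω) (z ω)) t) ∂P
        = if t = 0 then ‖wstar i‖ ^ 2 else errorSeq p n M T t σ wstar i := by
  induction t with
  | zero =>
    refine ⟨AEFunctionOf.const 0, fun i => ?_⟩
    simp [sequential, modelError]
  | succ t ih =>
    obtain ⟨ih1, ih2⟩ := ih (by omega)
    rcases Nat.eq_zero_or_pos t with rfl | ht
    · have hstep := hdata.fit_dataset (t := 1) (h := 0) le_rfl htT (by omega)
        (by simpa [size] using hn) wstar (D := {d | d.1 ≤ 0}) (by simp) ih1 (fun i => (ih2 i).1)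
      refine ⟨hstep.1.mono ?_, fun i => ⟨(hstep.2 i).1, ?_⟩⟩
      · rintro c (hc | hc)
        · exact (show c.1.1.1 ≤ 0 from hc).trans zero_le_one
        · have h0 := Set.mem_singleton_iff.1 hc
          show c.1.1.1 ≤ 0 + 1
          rw [h0]
      · refine (hstep.2 i).2.trans ?_
        rw [(ih2 i).2, if_neg (Nat.succ_ne_zero 0), zero_add, errorSeq_one _ htT]
        simp [size, taskOf, rCoef]
    · have hstep := hdata.sequentialInner_error htT
        (by simpa using hdvd (t + 1) (by omega) htT) hn hM wstar ih1 (fun i => (ih2 i).1) t le_rfl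
      refine ⟨hstep.1.mono ?_, fun i => ⟨(hstep.2 i).1, ?_⟩⟩
      · rintro c (hc | ⟨hc, _⟩)
        · exact le_trans hc (Nat.le_succ t)
        · exact le_of_eq hc
      · refine (hstep.2 i).2.trans ?_
        rw [(ih2 i).2, if_neg ht.ne', if_neg (Nat.succ_ne_zero t), errorSeq_succ ht htT]

end Sequential

/-! ### From expected errors to forgetting and generalization error. -/

section Metrics

variable {p T : ℕ} {Ω : Type*} [MeasurableSpace Ω] {P : Measure Ω}

lemma forgetting_eq {wstar : ℕ → EuclideanSpace ℝ (Fin p)} {w : Ω → ℕ → EuclideanSpace ℝ (Fin p)}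
    {e : ℕ → ℕ → ℝ}
    (hint : ∀ i t, 1 ≤ i → i ≤ T → 1 ≤ t → t ≤ T →
      Integrable (fun ω => modelError wstar i (w ω t)) P)
    (he : ∀ i t, 1 ≤ t → t ≤ T → ∫ ω, modelError wstar i (w ω t) ∂P = e t i) :
    forgetting P wstar w T
      = 1 / ((T : ℝ) - 1) * ∑ i ∈ Finset.Icc 1 (T - 1), (e T i - e i i) := by
  rw [forgetting]
  congr 1
  refine Finset.sum_congr rfl fun i hi => ?_
  obtain ⟨h1, h2⟩ := Finset.mem_Icc.1 hi
  rw [integral_sub (hint i T h1 (by omega) (by omega) le_rfl)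
    (hint i i h1 (by omega) h1 (by omega)), he i T (by omega) le_rfl, he i i h1 (by omega)]

lemma genError_eq {wstar : ℕ → EuclideanSpace ℝ (Fin p)} {w : Ω → ℕ → EuclideanSpace ℝ (Fin p)}
    {e : ℕ → ℕ → ℝ} (hT : 1 ≤ T)
    (he : ∀ i t, 1 ≤ t → t ≤ T → ∫ ω, modelError wstar i (w ω t) ∂P = e t i) :
    genError P wstar w T = 1 / (T : ℝ) * ∑ i ∈ Finset.Icc 1 T, e T i := by
  rw [genError]
  congr 1
  exact Finset.sum_congr rfl fun i _ => he i T hT le_rfl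

/-- If the expected errors have the form `d₀ ‖w_i*‖² + ∑ d ‖w_j* - w_k*‖² + noise`, then forgetting
and generalization error have the corresponding form. -/
lemma metrics_eq {wstar : ℕ → EuclideanSpace ℝ (Fin p)} {w : Ω → ℕ → EuclideanSpace ℝ (Fin p)}
    (hT : 2 ≤ T) {d0 noise : ℕ → ℝ} {d : ℕ → ℕ → ℕ → ℕ → ℝ} {e : ℕ → ℕ → ℝ}
    (hint : ∀ i t, 1 ≤ i → i ≤ T → 1 ≤ t → t ≤ T →
      Integrable (fun ω => modelError wstar i (w ω t)) P)
    (he : ∀ i t, 1 ≤ t → t ≤ T → ∫ ω, modelError wstar i (w ω t) ∂P = e t i)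
    (hd : ∀ i t, i ∈ Finset.Icc 1 T → e t i = d0 t * ‖wstar i‖ ^ 2
      + (∑ j ∈ Finset.Icc 1 T, ∑ k ∈ Finset.Icc 1 T, d i j k t * ‖wstar j - wstar k‖ ^ 2)
      + noise t) :
    forgetting P wstar w T = 1 / ((T : ℝ) - 1) *
        (∑ i ∈ Finset.Icc 1 (T - 1), (d0 T - d0 i) * ‖wstar i‖ ^ 2
          + ∑ i ∈ Finset.Icc 1 (T - 1), ∑ j ∈ Finset.Icc 1 T, ∑ k ∈ Finset.Icc 1 T,
              (d i j k T - d i j k i) * ‖wstar j - wstar k‖ ^ 2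
          + ∑ i ∈ Finset.Icc 1 (T - 1), (noise T - noise i)) ∧
      genError P wstar w T = 1 / (T : ℝ) *
        (d0 T * ∑ i ∈ Finset.Icc 1 T, ‖wstar i‖ ^ 2
          + ∑ i ∈ Finset.Icc 1 T, ∑ j ∈ Finset.Icc 1 T, ∑ k ∈ Finset.Icc 1 T,
              d i j k T * ‖wstar j - wstar k‖ ^ 2) + noise T := by
  constructor
  · rw [forgetting_eq hint he]
    congr 1
    rw [← Finset.sum_add_distrib, ← Finset.sum_add_distrib]
    refine Finset.sum_congr rfl fun i hi => ?_
    have hi' : i ∈ Finset.Icc 1 T := by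
      simp only [Finset.mem_Icc] at hi ⊢
      omega
    rw [hd i T hi', hd i i hi']
    simp_rw [sub_mul, Finset.sum_sub_distrib]
    ring
  · have hT0 : (T : ℝ) ≠ 0 := by positivity
    rw [genError_eq (by omega) he, Finset.sum_congr rfl fun i hi => hd i T hi,
      Finset.sum_add_distrib, Finset.sum_add_distrib, ← Finset.mul_sum]
    simp only [Finset.sum_const, Nat.card_Icc, Nat.add_sub_cancel, nsmul_eq_mul]
    field_simp

end Metrics

end Rehearsal

theorem theorem1 {Ω : Type*} [MeasurableSpace Ω] (P : Measure Ω) [IsProbabilityMeasure P]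
    (p n M T : ℕ) (σ : ℝ≥0) (hT : 2 ≤ T)
    (hM : ∀ t, 2 ≤ t → t ≤ T → (t - 1) ∣ M)
    (wstar : ℕ → EuclideanSpace ℝ (Fin p))
    (X : Ω → Features p n M) (z : Ω → Outputs n M)
    (hdata : IsGaussianData P T p n M σ X z) :
    -- concurrent rehearsal
    (n + M + 1 < p →
      (∀ i t, 1 ≤ i → i ≤ T → 1 ≤ t → t ≤ T → Integrable
        (fun ω => modelError wstar i (concurrent (X ω) (labels wstar (X ω) (z ω)) t)) P) ∧
      forgetting P wstar (fun ω => concurrent (X ω) (labels wstar (X ω) (z ω))) T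
        = 1 / ((T : ℝ) - 1) *
          (∑ i ∈ Finset.Icc 1 (T - 1), c0Conc p n M T i * ‖wstar i‖ ^ 2
            + ∑ i ∈ Finset.Icc 1 (T - 1), ∑ j ∈ Finset.Icc 1 T, ∑ k ∈ Finset.Icc 1 T,
                cConc p n M T i j k * ‖wstar j - wstar k‖ ^ 2
            + ∑ i ∈ Finset.Icc 1 (T - 1), (noiseConc p n M T σ - noiseConc p n M i σ)) ∧
      genError P wstar (fun ω => concurrent (X ω) (labels wstar (X ω) (z ω))) T
        = 1 / (T : ℝ) *
          (d0Conc p n M T * ∑ i ∈ Finset.Icc 1 T, ‖wstar i‖ ^ 2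
            + ∑ i ∈ Finset.Icc 1 T, ∑ j ∈ Finset.Icc 1 T, ∑ k ∈ Finset.Icc 1 T,
                dConc p n M i j k T * ‖wstar j - wstar k‖ ^ 2)
          + noiseConc p n M T σ) ∧
    -- sequential rehearsal
    (n + 1 < p → M + 1 < p →
      (∀ i t, 1 ≤ i → i ≤ T → 1 ≤ t → t ≤ T → Integrable
        (fun ω => modelError wstar i (sequential (X ω) (labels wstar (X ω) (z ω)) t)) P) ∧
      forgetting P wstar (fun ω => sequential (X ω) (labels wstar (X ω) (z ω))) T
        = 1 / ((T : ℝ) - 1) *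
          (∑ i ∈ Finset.Icc 1 (T - 1), c0Seq p n M T i * ‖wstar i‖ ^ 2
            + ∑ i ∈ Finset.Icc 1 (T - 1), ∑ j ∈ Finset.Icc 1 T, ∑ k ∈ Finset.Icc 1 T,
                cSeq p n M T i j k * ‖wstar j - wstar k‖ ^ 2
            + ∑ i ∈ Finset.Icc 1 (T - 1), (noiseSeq p n M T σ - noiseSeq p n M i σ)) ∧
      genError P wstar (fun ω => sequential (X ω) (labels wstar (X ω) (z ω))) T
        = 1 / (T : ℝ) *
          (d0Seq p n M T * ∑ i ∈ Finset.Icc 1 T, ‖wstar i‖ ^ 2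
            + ∑ i ∈ Finset.Icc 1 T, ∑ j ∈ Finset.Icc 1 T, ∑ k ∈ Finset.Icc 1 T,
                dSeq p n M i j k T * ‖wstar j - wstar k‖ ^ 2)
          + noiseSeq p n M T σ) := by
  refine ⟨fun hp => ?_, fun hn hM' => ?_⟩
  · have H := hdata.concurrent_error hM hp wstar
    exact ⟨fun i t _ _ _ ht => ((H t ht).2 i).1,
      metrics_eq hT (d0 := d0Conc p n M) (noise := fun t => noiseConc p n M t σ)
        (d := dConc p n M) (e := fun t i => errorConc p n M T t σ wstar i)
        (fun i t _ _ _ ht => ((H t ht).2 i).1)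
        (fun i t h1 ht => ((H t ht).2 i).2.trans (if_neg (by omega)))
        (fun i t hi => by
          rw [errorConc, sum_dConc (D := fun j k => ‖wstar j - wstar k‖ ^ 2)
            (fun j k => by rw [norm_sub_rev]) (by simp) hi])⟩
  · have H := hdata.sequential_error hM hn hM' wstar
    exact ⟨fun i t _ _ _ ht => ((H t ht).2 i).1,
      metrics_eq hT (d0 := d0Seq p n M) (noise := fun t => noiseSeq p n M t σ)
        (d := dSeq p n M) (e := fun t i => errorSeq p n M T t σ wstar i)
        (fun i t _ _ _ ht => ((H t ht).2 i).1)
        (fun i t h1 ht => ((H t ht).2 i).2.trans (if_neg (by omega)))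
        (fun i t hi => by
          rw [errorSeq, sum_dSeq (D := fun j k => ‖wstar j - wstar k‖ ^ 2) hi])⟩
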